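/- Let $G$ be a totally disconnected locally compact group. A unitary representation of $G$ is a complex Hilbert space $V$ with a continuous action $G\times V\to V$ by linear maps preserving the inner product; it is irreducible if $V\neq 0$ and $V$ has no closed $G$-submodules other than $0$ and $V$. A smooth representation of $G$ is a complex vector space $V$ with a linear $G$-action such that the stabilizer of every vector is open; it is irreducible if $V\neq 0$ and $V$ has no $G$-submodules other than $0$ and $V$. For a subgroup $K\le G$ write $V^K$ for the space of $K$-fixed vectors. The irreducible unitary (respectively smooth) representations of $G$ are uniformly admissible if for every compact open subgroup $K\le G$ there is $n\in\mathbb{N}$ such that $\dim_{\mathbb{C}} V^K\le n$ for every irreducible unitary (respectively smooth) representation $V$ of $G$. (1) Let $K$ be a compact open subgroup of $G$ with $|G/K|<2^{\aleph_0}$ and let $n\in\mathbb{N}$. Then the following are equivalent: (a) every irreducible unitary representation $V$ of $G$ satisfies $\dim V^K\le n$; (b) every irreducible smooth representation $V$ of $G$ satisfies $\dim V^K\le n$. The implication (b)$\Rightarrow$(a) holds for every compact open subgroup $K$, without assuming $|G/K|<2^{\aleph_0}$. (2) If $|G/K|<2^{\aleph_0}$ for some compact open subgroup $K\le G$, then the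 irreducible unitary representations of $G$ are uniformly admissible if and only if the irreducible smooth representations of $G$ are uniformly admissible. The implication from smooth to unitary holds without assuming $|G/K|<2^{\aleph_0}$. -/

import Mathlib

universe u v w

/-- The subspace `V^K` of vectors fixed by the subgroup `K`. -/
def fixedVectors {G V : Type*} [Group G] [AddCommGroup V] [Module ℂ V]
    (ρ : Representation ℂ G V) (K : Subgroup G) : Submodule ℂ V where
  carrier := {x | ∀ g ∈ K, ρ g x = x}
  zero_mem' := fun g _ => map_zero (ρ g)
  add_mem' := fun {x y} hx hy g hg => by rw [map_add, hx g hg, hy g hg]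
  smul_mem' := fun c x hx g hg => by rw [map_smul, hx g hg]

/-- A representation on a complex vector space is smooth if all stabilizers of vectors are open. -/
def IsSmoothRep {G V : Type*} [Group G] [TopologicalSpace G] [AddCommGroup V] [Module ℂ V]
    (ρ : Representation ℂ G V) : Prop :=
  ∀ x : V, IsOpen {g : G | ρ g x = x}

/-- A unitary representation on a complex inner product space: the action map `G × V → V` is
(jointly) continuous and preserves the inner product. (Completeness of `V` is required separately.)
-/
structure IsUnitaryRep {G V : Type*} [Group G] [TopologicalSpace G]
    [NormedAddCommGroup V] [InnerProductSpace ℂ V] (ρ : Representation ℂ G V) : Prop where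
  continuous_action : Continuous fun p : G × V => ρ p.1 p.2
  inner_map_map : ∀ (g : G) (x y : V), inner ℂ (ρ g x) (ρ g y) = inner ℂ x y

/-- Topological irreducibility: `V` is nonzero and its only closed subrepresentations are `0` and
`V`. -/
structure IsTopologicallyIrreducible {G V : Type*} [Group G]
    [NormedAddCommGroup V] [InnerProductSpace ℂ V] (ρ : Representation ℂ G V) : Prop where
  nontrivial : Nontrivial V
  eq_bot_or_eq_top : ∀ W : Subrepresentation ρ, IsClosed (W : Set V) → W = ⊥ ∨ W = ⊤

/-- Every irreducible unitary representation `V` of `G` satisfies `dim V^K ≤ n`. The universe of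
`V` is at least that of `G`, so every isomorphism class of irreducible representations occurs. -/
def UnitaryFixedDimLE (G : Type u) [Group G] [TopologicalSpace G] (K : Subgroup G) (n : ℕ) :
    Prop :=
  ∀ (V : Type (max u v)) [NormedAddCommGroup V] [InnerProductSpace ℂ V] [CompleteSpace V]
    (ρ : Representation ℂ G V), IsUnitaryRep ρ → IsTopologicallyIrreducible ρ →
      Module.rank ℂ (fixedVectors ρ K) ≤ n

/-- Every (algebraically) irreducible smooth representation `V` of `G` satisfies `dim V^K ≤ n`. The
universe of `V` is at least that of `G`, so every isomorphism class of irreducible representations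
occurs. -/
def SmoothFixedDimLE (G : Type u) [Group G] [TopologicalSpace G] (K : Subgroup G) (n : ℕ) :
    Prop :=
  ∀ (V : Type (max u v)) [AddCommGroup V] [Module ℂ V]
    (ρ : Representation ℂ G V), IsSmoothRep ρ → ρ.IsIrreducible →
      Module.rank ℂ (fixedVectors ρ K) ≤ n

/-- The irreducible unitary representations of `G` are uniformly admissible. -/
def UnitaryUniformlyAdmissible (G : Type u) [Group G] [TopologicalSpace G] : Prop :=
  ∀ K : Subgroup G, IsCompact (K : Set G) → IsOpen (K : Set G) →
    ∃ n : ℕ, UnitaryFixedDimLE.{u, v} G K n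

/-- The irreducible smooth representations of `G` are uniformly admissible. -/
def SmoothUniformlyAdmissible (G : Type u) [Group G] [TopologicalSpace G] : Prop :=
  ∀ K : Subgroup G, IsCompact (K : Set G) → IsOpen (K : Set G) →
    ∃ n : ℕ, SmoothFixedDimLE.{u, v} G K n

/-! Both bounds are compared with one polynomial identity in the Hecke algebra `A =
End_G(ℂ[G/K])ᵒᵖ`, which acts on `V^K = Hom_G(ℂ[G/K], V)` for every representation `V`. For each `n`
there is a degree `r` such that the standard polynomial `S_r` vanishes on matrices of size at most
`n` but not on those of size `n + 1` (`exists_standardIdentityEnd`). Either bound on the dimensions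
forces `S_r = 0` on `A`, and this identity in turn forces `dim V^K ≤ n`.

From representations to `A`: if all irreducible unitary `V` satisfy the bound, values of `S_r` act
by zero on every `V^K`, hence vanish by a Gelfand–Raikov argument
(`exists_irreducible_orbitMap_ne_zero`): extreme points of the compact set of normalized invariant
positive kernels on `G/K` give irreducible representations, and they separate elements of `ℂ[G/K]`.
If all irreducible smooth `V` satisfy it, values of `S_r` lie in every maximal left ideal, because
each such ideal contains the annihilator of a fixed vector in some irreducible smooth `V`
(`HeckeAlgebra.exists_irreducible_of_isMaximal`). So they lie in the Jacobson radical, which acts by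
zero in every star-closed representation on a Hilbert space (`map_eq_zero_of_mem_jacobson`), in
particular in the faithful one coming from `ℓ²(G/K)`.

From `A` to representations: for irreducible unitary `V` the image of `A` on `V^K` is self-adjoint
and topologically irreducible, so von Neumann density extends the identity to all bounded operators
on `V^K`. For irreducible smooth `V`, the space `V^K` is zero or a simple `A`-module, and Jacobson
density applies once the commutant is known to be `ℂ`. Only this use of Schur's lemma needs `|G/K| <
2^ℵ₀`: it makes `dim V` smaller than the continuum. -/

/-- The standard polynomial of degree `r`, as an alternating map. -/
noncomputable def standardPolynomial (r : ℕ) (R : Type*) [Ring R] [Algebra ℂ R] :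
    R [⋀^Fin r]→ₗ[ℂ] R :=
  MultilinearMap.alternatization (MultilinearMap.mkPiAlgebraFin ℂ r R)

/-! ### Standard identities of matrix algebras -/

section StandardPolynomial

theorem standardPolynomial_apply {r : ℕ} {R : Type*} [Ring R] [Algebra ℂ R] (a : Fin r → R) :
    standardPolynomial r R a =
      ∑ σ : Equiv.Perm (Fin r), Equiv.Perm.sign σ • (List.ofFn fun i => a (σ i)).prod := by
  simp [standardPolynomial, MultilinearMap.alternatization_apply]

theorem map_standardPolynomial {r : ℕ} {R S : Type*} [Ring R] [Algebra ℂ R] [Ring S] [Algebra ℂ S]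
    {F : Type*} [FunLike F R S] [RingHomClass F R S] (f : F) (a : Fin r → R) :
    f (standardPolynomial r R a) = standardPolynomial r S (fun i => f (a i)) := by
  simp only [standardPolynomial_apply, map_sum, Units.smul_def, map_zsmul, map_list_prod,
    List.map_ofFn, Function.comp_def]

theorem comp_prod_of_comp_eq {V W : Type*} [AddCommGroup V] [Module ℂ V] [AddCommGroup W]
    [Module ℂ W] {r : ℕ} (p : V →ₗ[ℂ] W) (f : Fin r → Module.End ℂ V) (g : Fin r → Module.End ℂ W)
    (h : ∀ i, p ∘ₗ f i = g i ∘ₗ p) :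
    p ∘ₗ (List.ofFn f).prod = (List.ofFn g).prod ∘ₗ p := by
  induction r with
  | zero => ext; simp
  | succ r ih =>
    have := ih (fun i => f i.succ) (fun i => g i.succ) (fun i => h _)
    rw [List.ofFn_succ, List.ofFn_succ, List.prod_cons, List.prod_cons, Module.End.mul_eq_comp,
      Module.End.mul_eq_comp, ← LinearMap.comp_assoc, h, LinearMap.comp_assoc, this,
      LinearMap.comp_assoc]

/-- An intertwining relation passes to products and sums; this moves the identity between a space
and its subspaces or quotients. -/
theorem comp_standardPolynomial_of_comp_eq {V W : Type*} [AddCommGroup V] [Module ℂ V]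
    [AddCommGroup W] [Module ℂ W] {r : ℕ} (p : V →ₗ[ℂ] W) (f : Fin r → Module.End ℂ V)
    (g : Fin r → Module.End ℂ W) (h : ∀ i, p ∘ₗ f i = g i ∘ₗ p) :
    p ∘ₗ standardPolynomial r _ f = standardPolynomial r _ g ∘ₗ p := by
  rw [standardPolynomial_apply, standardPolynomial_apply]
  ext x
  simp only [LinearMap.comp_apply, LinearMap.sum_apply, map_sum]
  refine Finset.sum_congr rfl fun σ _ => ?_
  have := congrArg (fun t => t x)
    (comp_prod_of_comp_eq p (fun i => f (σ i)) (fun i => g (σ i)) (fun i => h _))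
  simp only [LinearMap.comp_apply] at this
  simp [Units.smul_def, this]

/-- Left multiplication by `e` kills every monomial that does not begin with `c`; the surviving
permutations fix `0` and are those of the remaining `r` arguments, with the same sign. -/
theorem mul_standardPolynomial_cons {r : ℕ} {R : Type*} [Ring R] [Algebra ℂ R] (e c : R)
    (a : Fin r → R) (hc : e * c = c) (ha : ∀ i, e * a i = 0) :
    e * standardPolynomial (r + 1) R (Fin.cons c a) = c * standardPolynomial r R a := by
  rw [standardPolynomial_apply, standardPolynomial_apply, Finset.mul_sum, Finset.mul_sum,
    ← Equiv.sum_comp Equiv.Perm.decomposeFin.symm, Fintype.sum_prod_type, Fin.sum_univ_succ]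
  have h0 : ∑ i : Fin r, ∑ τ : Equiv.Perm (Fin r),
      e * (Equiv.Perm.sign (Equiv.Perm.decomposeFin.symm (i.succ, τ)) •
        (List.ofFn fun j => (Fin.cons c a : Fin (r + 1) → R)
          (Equiv.Perm.decomposeFin.symm (i.succ, τ) j)).prod) = 0 := by
    refine Finset.sum_eq_zero fun i _ => Finset.sum_eq_zero fun τ _ => ?_
    rw [List.ofFn_succ, List.prod_cons, Equiv.Perm.decomposeFin_symm_apply_zero, Fin.cons_succ,
      mul_smul_comm, ← mul_assoc, ha, zero_mul, smul_zero]
  rw [h0, add_zero]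
  refine Finset.sum_congr rfl fun τ _ => ?_
  rw [List.ofFn_succ, List.prod_cons, Equiv.Perm.decomposeFin_symm_apply_zero, Fin.cons_zero,
    mul_smul_comm, ← mul_assoc, hc, mul_smul_comm, Equiv.Perm.decomposeFin.symm_sign, if_pos rfl,
    one_mul]
  simp [Equiv.Perm.decomposeFin_symm_apply_succ]

/-- The standard identity of degree `r` holds in the endomorphism algebra of `ℂ^d`. -/
def StandardIdentityEnd (r d : ℕ) : Prop :=
  ∀ a : Fin r → Module.End ℂ (Fin d → ℂ), standardPolynomial r _ a = 0

/-- An alternating map vanishes on dependent families, and the matrix algebra has dimension `d * d`.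
-/
theorem standardIdentityEnd_of_lt {r d : ℕ} (h : d * d < r) : StandardIdentityEnd r d := by
  intro a
  refine AlternatingMap.map_linearDependent _ _ fun hli => ?_
  have := hli.fintype_card_le_finrank
  simp [Module.finrank_linearMap] at this
  omega

theorem not_standardIdentityEnd_succ {r d : ℕ} (h : ¬ StandardIdentityEnd r d) :
    ¬ StandardIdentityEnd (r + 1) (d + 1) := by
  simp only [StandardIdentityEnd, not_forall] at h ⊢
  obtain ⟨a, ha⟩ := h
  obtain ⟨x, hx⟩ : ∃ x, standardPolynomial r _ a x ≠ 0 := by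
    by_contra! hx
    exact ha (LinearMap.ext hx)
  obtain ⟨i, hi⟩ : ∃ i, standardPolynomial r _ a x i ≠ 0 := by
    by_contra! hi
    exact hx (funext hi)
  let p : (Fin (d + 1) → ℂ) →ₗ[ℂ] (Fin d → ℂ) := LinearMap.funLeft ℂ ℂ Fin.succ
  let q : (Fin d → ℂ) →ₗ[ℂ] (Fin (d + 1) → ℂ) :=
    LinearMap.pi (Fin.cons 0 fun j => LinearMap.proj j)
  let s : ℂ →ₗ[ℂ] (Fin (d + 1) → ℂ) := LinearMap.single ℂ (fun _ => ℂ) 0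
  let t : (Fin (d + 1) → ℂ) →ₗ[ℂ] ℂ := LinearMap.proj 0
  have hpq : p ∘ₗ q = LinearMap.id := by ext; simp [p, q]
  have htq : t ∘ₗ q = 0 := by ext; simp [t, q]
  have hts : t ∘ₗ s = LinearMap.id := by ext; simp [t, s]
  -- In block form `b j` is `a j` on the last `d` coordinates, and `c` is the matrix unit sending
  -- old coordinate `i` to the new coordinate `0`. With `e = s ∘ₗ t`, the projection to coordinate
  -- `0`, one has `e c = c` and `e (b j) = 0`.
  let b : Fin r → Module.End ℂ (Fin (d + 1) → ℂ) := fun j => q ∘ₗ a j ∘ₗ p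
  let c : Module.End ℂ (Fin (d + 1) → ℂ) := s ∘ₗ LinearMap.proj i ∘ₗ p
  refine ⟨Fin.cons c b, fun h0 => hi ?_⟩
  have key := mul_standardPolynomial_cons (s ∘ₗ t) c b
    (by simp only [c, Module.End.mul_eq_comp]
        rw [LinearMap.comp_assoc, ← LinearMap.comp_assoc (g := s), hts, LinearMap.id_comp])
    (by intro j
        simp only [b, Module.End.mul_eq_comp]
        rw [LinearMap.comp_assoc, ← LinearMap.comp_assoc (g := q), htq]; simp)
  rw [h0, mul_zero] at key
  have h1 : p ∘ₗ standardPolynomial r _ b = standardPolynomial r _ a ∘ₗ p :=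
    comp_standardPolynomial_of_comp_eq p b a fun j => by
      simp only [b]; rw [← LinearMap.comp_assoc, hpq, LinearMap.id_comp]
  have h2 := congrArg (fun f => t (f (q x))) key
  have h3 := congrArg (fun f => f (q x)) h1
  have h4 : p (q x) = x := congrArg (fun f => f x) hpq
  simp only [LinearMap.comp_apply, h4] at h3
  have h5 (y : ℂ) : t (s y) = y := congrArg (fun f => f y) hts
  simp only [c, Module.End.mul_apply, LinearMap.comp_apply, h3, h5] at h2
  simpa using h2.symm

/-- Some standard identity holds for all matrices of size at most `n` but not for matrices of size
`n + 1`. -/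
theorem exists_standardIdentityEnd (n : ℕ) :
    ∃ r, (∀ d ≤ n, StandardIdentityEnd r d) ∧ ¬ StandardIdentityEnd r (n + 1) := by
  classical
  have hex : ∃ r, ∀ d ≤ n, StandardIdentityEnd r d :=
    ⟨n * n + 1, fun d hd => standardIdentityEnd_of_lt (by nlinarith)⟩
  -- The least such degree works. If it is `0`, then `S_0 = 1` is nonzero in size `n + 1`. If it is
  -- `r + 1`, then `S_r` fails in some size `d ≤ n`, so `S_{r+1}` fails in size `d + 1`, which
  -- forces `d = n`.
  refine ⟨Nat.find hex, Nat.find_spec hex, ?_⟩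
  have hspec := Nat.find_spec hex
  rcases hr : Nat.find hex with _ | r
  · intro h
    have := congrArg (fun f => f (fun _ => 1) 0) (h Fin.elim0)
    simp [standardPolynomial_apply] at this
  · have := Nat.find_min hex (m := r) (by omega)
    push Not at this
    obtain ⟨d, hd, hdr⟩ := this
    have h1 := not_standardIdentityEnd_succ hdr
    rw [hr] at hspec
    have : d = n := by
      by_contra hne
      exact h1 (hspec _ (by omega))
    exact this ▸ h1

theorem standardPolynomial_end_eq_zero {r n : ℕ} (hr : ∀ d ≤ n, StandardIdentityEnd r d)
    {V : Type*} [AddCommGroup V] [Module ℂ V] (hV : Module.rank ℂ V ≤ n)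
    (a : Fin r → Module.End ℂ V) : standardPolynomial r _ a = 0 := by
  have : FiniteDimensional ℂ V :=
    Module.rank_lt_aleph0_iff.mp (hV.trans_lt (Cardinal.natCast_lt_aleph0))
  have hd : Module.finrank ℂ V ≤ n := Module.finrank_le_of_rank_le hV
  let e : V ≃ₗ[ℂ] (Fin (Module.finrank ℂ V) → ℂ) := (Module.finBasis ℂ V).equivFun
  have h := comp_standardPolynomial_of_comp_eq e.toLinearMap a
    (fun i => e.toLinearMap ∘ₗ a i ∘ₗ e.symm.toLinearMap) (fun i => by ext; simp)
  rw [hr _ hd, LinearMap.zero_comp] at h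
  ext x
  have := congrArg (fun f => f x) h
  simpa using this

/-- If every finite-rank operator on a space spanned by more than `n` independent vectors is
induced from elements satisfying a standard identity, the identity holds in size `n + 1`. -/
theorem standardIdentityEnd_of_comp {r m : ℕ} {V : Type*} [AddCommGroup V] [Module ℂ V]
    (p : (Fin m → ℂ) →ₗ[ℂ] V) (hp : Function.Injective p)
    (h : ∀ g : Fin r → Module.End ℂ (Fin m → ℂ), ∃ f : Fin r → Module.End ℂ V,
      (∀ i, p ∘ₗ g i = f i ∘ₗ p) ∧ standardPolynomial r _ f = 0) :
    StandardIdentityEnd r m := by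
  intro g
  obtain ⟨f, hf, hf0⟩ := h g
  have := comp_standardPolynomial_of_comp_eq p g f hf
  rw [hf0, LinearMap.zero_comp] at this
  refine LinearMap.ext fun x => hp ?_
  simpa using congrArg (fun f => f x) this

/-- A space of dimension larger than `n` contains a copy of `ℂ^(n+1)`. -/
theorem exists_injective_of_lt_rank {n : ℕ} {V : Type*} [AddCommGroup V] [Module ℂ V]
    (h : ¬ Module.rank ℂ V ≤ n) :
    ∃ p : (Fin (n + 1) → ℂ) →ₗ[ℂ] V, Function.Injective p := by
  have h' : ((n + 1 : ℕ) : Cardinal) ≤ Module.rank ℂ V := by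
    rw [not_le] at h
    simpa [Cardinal.succ_natCast] using Order.succ_le_of_lt h
  obtain ⟨b, hb⟩ := Module.le_rank_iff_exists_linearMap.mp h'
  exact ⟨b, hb⟩

end StandardPolynomial

/-! ### The permutation module `ℂ[G/K]` and Frobenius reciprocity -/

section OrbitMap

variable {G : Type*} [Group G] {K : Subgroup G}

/-- The permutation representation of `G` on `ℂ[G/K]`. -/
noncomputable def cosetRep (K : Subgroup G) : Representation ℂ G (G ⧸ K →₀ ℂ) where
  toFun g := Finsupp.lmapDomain ℂ ℂ (g • ·)
  map_one' := by ext; simp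
  map_mul' g h := by ext; simp [mul_smul]

@[simp]
theorem cosetRep_single (g : G) (x : G ⧸ K) (c : ℂ) :
    cosetRep K g (Finsupp.single x c) = Finsupp.single (g • x) c := by
  simp [cosetRep]

/-- The base point of `ℂ[G/K]`. -/
noncomputable def baseVector (K : Subgroup G) : G ⧸ K →₀ ℂ :=
  Finsupp.single ((1 : G) : G ⧸ K) 1

theorem cosetRep_baseVector (g : G) :
    cosetRep K g (baseVector K) = Finsupp.single (g : G ⧸ K) 1 := by
  simp [baseVector]

theorem baseVector_mem_fixedVectors : baseVector K ∈ fixedVectors (cosetRep K) K := by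
  intro g hg
  rw [cosetRep_baseVector, baseVector]
  congr 1
  exact QuotientGroup.eq.mpr (by simpa using hg)

theorem coset_induction {p : (G ⧸ K →₀ ℂ) → Prop} (f : G ⧸ K →₀ ℂ) (zero : p 0)
    (add : ∀ x y, p x → p y → p (x + y))
    (smul : ∀ (c : ℂ) (g : G), p (c • cosetRep K g (baseVector K))) : p f := by
  induction f using Finsupp.induction_linear with
  | zero => exact zero
  | add x y hx hy => exact add x y hx hy
  | single x c =>
    induction x using QuotientGroup.induction_on with
    | H g => simpa [cosetRep_baseVector] using smul c g

variable {V : Type*} [AddCommGroup V] [Module ℂ V] (ρ : Representation ℂ G V)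

/-- The equivariant map `ℂ[G/K] → V` determined by a `K`-fixed vector. -/
noncomputable def orbitMap (v : V) : (G ⧸ K →₀ ℂ) →ₗ[ℂ] V :=
  Finsupp.linearCombination ℂ fun x : G ⧸ K => ρ x.out v

variable {ρ}

theorem orbitMap_single {v : V} (hv : v ∈ fixedVectors ρ K) (g : G) (c : ℂ) :
    orbitMap ρ v (Finsupp.single (g : G ⧸ K) c) = c • ρ g v := by
  obtain ⟨h, hh⟩ := QuotientGroup.mk_out_eq_mul K g
  rw [orbitMap, Finsupp.linearCombination_single, hh, map_mul, Module.End.mul_apply,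
    hv h h.2]

theorem orbitMap_cosetRep_baseVector {v : V} (hv : v ∈ fixedVectors ρ K) (g : G) :
    orbitMap ρ v (cosetRep K g (baseVector K)) = ρ g v := by
  rw [cosetRep_baseVector, orbitMap_single hv, one_smul]

theorem orbitMap_baseVector {v : V} (hv : v ∈ fixedVectors ρ K) :
    orbitMap ρ v (baseVector K) = v := by
  rw [baseVector, orbitMap_single hv]; simp

theorem orbitMap_cosetRep {v : V} (hv : v ∈ fixedVectors ρ K) (g : G) (f : G ⧸ K →₀ ℂ) :
    orbitMap ρ v (cosetRep K g f) = ρ g (orbitMap ρ v f) := by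
  induction f using coset_induction with
  | zero => simp
  | add x y hx hy => simp [hx, hy]
  | smul c h =>
    rw [map_smul, map_smul, map_smul, map_smul, orbitMap_cosetRep_baseVector hv,
      ← Module.End.mul_apply, ← map_mul, orbitMap_cosetRep_baseVector hv, map_mul,
      Module.End.mul_apply]

theorem intertwining_mem_fixedVectors {W : Type*} [AddCommGroup W] [Module ℂ W]
    {τ : Representation ℂ G W} (T : V →ₗ[ℂ] W) (hT : ∀ g x, T (ρ g x) = τ g (T x)) {v : V}
    (hv : v ∈ fixedVectors ρ K) : T v ∈ fixedVectors τ K := fun g hg => by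
  rw [← hT, hv g hg]

/-- The base vector generates `ℂ[G/K]`, so an intertwiner is determined by its value there:
`Hom_G(ℂ[G/K], V) = V^K`. -/
theorem eq_orbitMap (T : (G ⧸ K →₀ ℂ) →ₗ[ℂ] V) (hT : ∀ g x, T (cosetRep K g x) = ρ g (T x)) :
    T = orbitMap ρ (T (baseVector K)) := by
  have hv := intertwining_mem_fixedVectors (ρ := cosetRep K) T hT baseVector_mem_fixedVectors
  ext x
  induction x using QuotientGroup.induction_on with
  | H g =>
    have h1 := hT g (baseVector K)
    rw [cosetRep_baseVector] at h1
    have h2 := orbitMap_single hv g 1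
    simp only [LinearMap.comp_apply, Finsupp.lsingle_apply]
    rw [h1, h2, one_smul]

variable (ρ) in
@[simp]
theorem orbitMap_add (v w : V) (f : G ⧸ K →₀ ℂ) :
    orbitMap ρ (v + w) f = orbitMap ρ v f + orbitMap ρ w f := by
  simp [orbitMap, Finsupp.linearCombination_apply, Finsupp.sum_add]

variable (ρ) in
@[simp]
theorem orbitMap_smul (c : ℂ) (v : V) (f : G ⧸ K →₀ ℂ) :
    orbitMap ρ (c • v) f = c • orbitMap ρ v f := by
  simp [orbitMap, Finsupp.linearCombination_apply, Finsupp.smul_sum, smul_comm c]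

end OrbitMap

/-! ### The Hecke algebra and its action on fixed vectors -/

section HeckeAlgebra

variable {G : Type*} [Group G] {K : Subgroup G}

/-- The opposite of the algebra of endomorphisms of a representation. -/
def OppositeEnd {V : Type*} [AddCommGroup V] [Module ℂ V] (ρ : Representation ℂ G V) : Type _ :=
  (Subalgebra.centralizer ℂ (Set.range ρ : Set (Module.End ℂ V)))ᵐᵒᵖ

noncomputable instance {V : Type*} [AddCommGroup V] [Module ℂ V] (ρ : Representation ℂ G V) :
    Ring (OppositeEnd ρ) :=
  inferInstanceAs (Ring (Subalgebra.centralizer ℂ (Set.range ρ : Set (Module.End ℂ V)))ᵐᵒᵖ)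

noncomputable instance {V : Type*} [AddCommGroup V] [Module ℂ V] (ρ : Representation ℂ G V) :
    Algebra ℂ (OppositeEnd ρ) :=
  inferInstanceAs (Algebra ℂ (Subalgebra.centralizer ℂ (Set.range ρ : Set (Module.End ℂ V)))ᵐᵒᵖ)

variable (K) in
/-- The Hecke algebra of `(G, K)`, as the opposite of the algebra of `G`-endomorphisms of
`ℂ[G/K]`. -/
abbrev HeckeAlgebra : Type _ :=
  OppositeEnd (cosetRep K)

namespace HeckeAlgebra

/-- The endomorphism of `ℂ[G/K]` underlying an element of the Hecke algebra. -/
def unop (a : HeckeAlgebra K) :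
    Subalgebra.centralizer ℂ (Set.range (cosetRep K) : Set (Module.End ℂ (G ⧸ K →₀ ℂ))) :=
  MulOpposite.unop a

/-- The `K`-fixed vector of `ℂ[G/K]` corresponding to an element of the Hecke algebra. -/
noncomputable def toVector : HeckeAlgebra K →ₗ[ℂ] (G ⧸ K →₀ ℂ) where
  toFun a := a.unop.1 (baseVector K)
  map_add' _ _ := rfl
  map_smul' _ _ := rfl

theorem unop_cosetRep (a : HeckeAlgebra K) (g : G) (f : G ⧸ K →₀ ℂ) :
    a.unop.1 (cosetRep K g f) = cosetRep K g (a.unop.1 f) :=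
  congrArg (fun T => T f)
    ((Subalgebra.mem_centralizer_iff ℂ).mp a.unop.2 (cosetRep K g) ⟨g, rfl⟩).symm

theorem toVector_mem (a : HeckeAlgebra K) : toVector a ∈ fixedVectors (cosetRep K) K :=
  intertwining_mem_fixedVectors _ (unop_cosetRep a) baseVector_mem_fixedVectors

theorem unop_eq_orbitMap (a : HeckeAlgebra K) : a.unop.1 = orbitMap (cosetRep K) (toVector a) :=
  eq_orbitMap _ (unop_cosetRep a)

theorem toVector_injective : Function.Injective (toVector : HeckeAlgebra K → _) := by
  intro a b h
  refine MulOpposite.unop_injective (show unop a = unop b from Subtype.ext ?_)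
  rw [unop_eq_orbitMap, unop_eq_orbitMap, h]

/-- The opposite algebra reverses composition, so that precomposition on `Hom_G(ℂ[G/K], V) = V^K`
becomes a left action. -/
theorem toVector_mul (a b : HeckeAlgebra K) :
    toVector (a * b) = orbitMap (cosetRep K) (toVector b) (toVector a) := by
  rw [← unop_eq_orbitMap]; rfl

theorem exists_toVector_eq {f : G ⧸ K →₀ ℂ} (hf : f ∈ fixedVectors (cosetRep K) K) :
    ∃ a : HeckeAlgebra K, toVector a = f := by
  refine ⟨MulOpposite.op ⟨orbitMap (cosetRep K) f, ?_⟩, orbitMap_baseVector hf⟩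
  rw [Subalgebra.mem_centralizer_iff]
  rintro _ ⟨g, rfl⟩
  ext1 x
  exact LinearMap.ext fun c => (orbitMap_cosetRep hf g _).symm

variable {V : Type*} [AddCommGroup V] [Module ℂ V] (ρ : Representation ℂ G V)

theorem orbitMap_toVector_mem {v : V} (hv : v ∈ fixedVectors ρ K) (a : HeckeAlgebra K) :
    orbitMap ρ v (toVector a) ∈ fixedVectors ρ K :=
  intertwining_mem_fixedVectors _ (orbitMap_cosetRep hv) (toVector_mem a)

theorem orbitMap_orbitMap {v : V} (hv : v ∈ fixedVectors ρ K) (a : HeckeAlgebra K)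
    (f : G ⧸ K →₀ ℂ) :
    orbitMap ρ (orbitMap ρ v (toVector a)) f =
      orbitMap ρ v (orbitMap (cosetRep K) (toVector a) f) := by
  rw [← unop_eq_orbitMap]
  have := eq_orbitMap (ρ := ρ) (orbitMap ρ v ∘ₗ a.unop.1) fun g x => by
    simp [unop_cosetRep, orbitMap_cosetRep hv]
  exact congrArg (fun T => T f) this.symm

/-- The action of the Hecke algebra on the `K`-fixed vectors of a representation. -/
noncomputable def action : HeckeAlgebra K →ₐ[ℂ] Module.End ℂ (fixedVectors ρ K) where
  toFun a :=
    { toFun := fun v => ⟨orbitMap ρ v.1 (toVector a), orbitMap_toVector_mem ρ v.2 a⟩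
      map_add' := fun v w => Subtype.ext (orbitMap_add ρ _ _ _)
      map_smul' := fun c v => Subtype.ext (orbitMap_smul ρ _ _ _) }
  map_one' := LinearMap.ext fun v => Subtype.ext (orbitMap_baseVector v.2)
  map_mul' a b := LinearMap.ext fun v => Subtype.ext <| by
    simp [toVector_mul, orbitMap_orbitMap ρ v.2]
  map_zero' := LinearMap.ext fun v => Subtype.ext (by simp)
  map_add' a b := LinearMap.ext fun v => Subtype.ext (by simp)
  commutes' c := LinearMap.ext fun v => Subtype.ext <| by
    have : toVector (algebraMap ℂ (HeckeAlgebra K) c) = c • baseVector K := rfl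
    change orbitMap ρ v.1 (toVector (algebraMap ℂ (HeckeAlgebra K) c)) = c • v.1
    rw [this, map_smul, orbitMap_baseVector v.2]

end HeckeAlgebra

end HeckeAlgebra

/-! ### Smoothness of `ℂ[G/K]` and averaging over `K` -/

section Averaging

variable {G : Type*} [Group G] [TopologicalSpace G] [IsTopologicalGroup G] {K : Subgroup G}

/-- The coset `gK` is fixed by the open subgroup `gKg⁻¹`, and a finite combination of cosets by a
finite intersection of these. -/
theorem isSmoothRep_cosetRep (hK : IsOpen (K : Set G)) : IsSmoothRep (cosetRep K) := by
  have key (f : G ⧸ K →₀ ℂ) : ∃ U : Subgroup G, IsOpen (U : Set G) ∧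
      ∀ g ∈ U, cosetRep K g f = f := by
    induction f using coset_induction with
    | zero => exact ⟨⊤, isOpen_univ, by simp⟩
    | add x y hx hy =>
      obtain ⟨U, hU, hUx⟩ := hx
      obtain ⟨U', hU', hUy⟩ := hy
      exact ⟨U ⊓ U', hU.inter hU', fun g hg => by rw [map_add, hUx g hg.1, hUy g hg.2]⟩
    | smul c g =>
      refine ⟨K.comap (MulAut.conj g⁻¹).toMonoidHom,
        hK.preimage (f := fun h => g⁻¹ * h * g⁻¹⁻¹) (by fun_prop), fun h hh => ?_⟩
      have hh' : g⁻¹ * h * g ∈ K := by simpa using hh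
      have := baseVector_mem_fixedVectors (K := K) _ hh'
      rw [map_smul, ← Module.End.mul_apply, ← map_mul]
      conv_rhs => rw [← this, ← Module.End.mul_apply, ← map_mul]
      simp [mul_assoc]
  intro f
  obtain ⟨U, hU, hUf⟩ := key f
  let S : Subgroup G :=
    { carrier := {g | cosetRep K g f = f}
      one_mem' := by simp
      mul_mem' := fun {a b} ha hb => by
        simp only [Set.mem_ofPred_eq] at *
        rw [map_mul, Module.End.mul_apply, hb, ha]
      inv_mem' := fun {a} ha => by
        simp only [Set.mem_ofPred_eq] at *
        conv_lhs => rw [← ha]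
        simp }
  exact Subgroup.isOpen_mono (H₁ := U) (H₂ := S) (fun g hg => hUf g hg) hU

/-- Finitely many vectors of a smooth representation are averaged simultaneously to `K`-fixed
vectors. -/
theorem exists_average (hKc : IsCompact (K : Set G)) {V : Type*} [AddCommGroup V]
    [Module ℂ V] {ρ : Representation ℂ G V} (hρ : IsSmoothRep ρ) (F : Finset V) :
    ∃ (n : ℕ) (t : Fin n → G), n ≠ 0 ∧ (∀ i, t i ∈ K) ∧
      ∀ v ∈ F, ∑ i, ρ (t i) v ∈ fixedVectors ρ K := by
  classical
  -- The common stabilizer of `F` in `K` is open, hence of finite index by compactness; the `t i`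
  -- represent its cosets, and left translation by `K` permutes the terms of the sum.
  let U : Subgroup K :=
    { carrier := {g | ∀ v ∈ F, ρ g v = v}
      one_mem' := by simp
      mul_mem' := fun {a b} ha hb v hv => by
        simp only [Set.mem_ofPred_eq] at *
        rw [Subgroup.coe_mul, map_mul, Module.End.mul_apply, hb v hv, ha v hv]
      inv_mem' := fun {a} ha v hv => by
        simp only [Set.mem_ofPred_eq] at *
        conv_lhs => rw [← ha v hv]
        simp }
  have hU : IsOpen (U : Set K) := by
    have : (U : Set K) = ⋂ v ∈ F, (Subtype.val : K → G) ⁻¹' {g | ρ g v = v} := by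
      ext g
      simp [U]
    rw [this]
    exact isOpen_biInter_finset fun v _ => (hρ v).preimage continuous_subtype_val
  have : CompactSpace K := isCompact_iff_compactSpace.mp hKc
  have : Finite (K ⧸ U) := Subgroup.quotient_finite_of_isOpen U hU
  have := Fintype.ofFinite (K ⧸ U)
  let e := (Fintype.equivFin (K ⧸ U)).symm
  refine ⟨Fintype.card (K ⧸ U), fun i => ((e i).out : K), Fintype.card_ne_zero,
    fun i => (e i).out.2, fun v hv => ?_⟩
  have hmk (q : K ⧸ U) (k : K) (hk : (k : K ⧸ U) = q) : ρ (q.out : K) v = ρ (k : G) v := by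
    subst hk
    obtain ⟨h, hh⟩ := QuotientGroup.mk_out_eq_mul U k
    rw [hh, Subgroup.coe_mul, map_mul, Module.End.mul_apply, h.2 v hv]
  rw [e.sum_comp (fun q => ρ (q.out : K) v)]
  intro k hk
  rw [map_sum, ← Equiv.sum_comp (MulAction.toPerm (⟨k, hk⟩ : K)) (fun q : K ⧸ U => ρ (q.out : K) v)]
  refine Finset.sum_congr rfl fun q _ => ?_
  have hq : (((⟨k, hk⟩ : K) * q.out : K) : K ⧸ U) = (⟨k, hk⟩ : K) • q := by
    rw [← smul_eq_mul, ← MulAction.Quotient.smul_coe]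
    exact congrArg _ (QuotientGroup.out_eq' q)
  rw [MulAction.toPerm_apply, hmk _ _ hq, Subgroup.coe_mul, map_mul, Module.End.mul_apply]

end Averaging

/-! ### Irreducible self-adjoint operator algebras, density, and the Jacobson radical -/

section Operators

variable {H : Type*} [NormedAddCommGroup H] [InnerProductSpace ℂ H] [CompleteSpace H]

/-- A set of operators is topologically irreducible if it has no proper nonzero closed invariant
subspace. -/
def IsIrreducibleOperatorSet (B : Set (H →L[ℂ] H)) : Prop :=
  ∀ N : Submodule ℂ H, IsClosed (N : Set H) → (∀ b ∈ B, ∀ x ∈ N, b x ∈ N) → N = ⊥ ∨ N = ⊤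

/-- If the spectrum contained two points, the positive and negative parts of `S - m`, with `m`
between them, would be nonzero with product zero; the kernel of one would be a proper nonzero closed
invariant subspace. -/
theorem IsSelfAdjoint.exists_eq_smul_one_of_commute {B : Set (H →L[ℂ] H)}
    (hB : IsIrreducibleOperatorSet B) {S : H →L[ℂ] H} (hS : IsSelfAdjoint S)
    (hcomm : ∀ b ∈ B, Commute S b) : ∃ c : ℂ, S = c • 1 := by
  rcases subsingleton_or_nontrivial H with hH | hH
  · exact ⟨0, Subsingleton.elim _ _⟩
  by_cases hsp : ∃ a ∈ spectrum ℝ S, ∃ b ∈ spectrum ℝ S, a < b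
  · exfalso
    obtain ⟨a, ha, b, hb, hab⟩ := hsp
    let m := (a + b) / 2
    let f : ℝ → ℝ := fun x => max 0 (m - x)
    let g : ℝ → ℝ := fun x => max 0 (x - m)
    have hf : Continuous f := by fun_prop
    have hg : Continuous g := by fun_prop
    have hfg : cfc f S * cfc g S = 0 := by
      rw [← cfc_mul f g S]
      rw [← cfc_const_zero ℝ S]
      refine cfc_congr fun x _ => ?_
      simp only [f, g]
      rcases le_total m x with h | h
      · rw [max_eq_left (by linarith), zero_mul]
      · rw [max_eq_left (a := (0 : ℝ)) (b := x - m) (by linarith), mul_zero]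
    have hf0 : cfc f S ≠ 0 := by
      intro h
      rw [← cfc_const_zero ℝ S] at h
      have := eqOn_of_cfc_eq_cfc h hf.continuousOn continuousOn_const hS ha
      simp only [f, m] at this
      rw [max_eq_right (by linarith)] at this
      linarith
    have hg0 : cfc g S ≠ 0 := by
      intro h
      rw [← cfc_const_zero ℝ S] at h
      have := eqOn_of_cfc_eq_cfc h hg.continuousOn continuousOn_const hS hb
      simp only [g, m] at this
      rw [max_eq_right (by linarith)] at this
      linarith
    have hN := hB (LinearMap.ker (cfc f S).toLinearMap) (cfc f S).isClosed_ker (by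
      intro b hb x hx
      have h1 : Commute (cfc f S) b := (hcomm b hb).cfc_real f
      have h2 := congrArg (fun T => T x) h1.eq
      have hx' : cfc f S x = 0 := hx
      have h3 : cfc f S (b x) = b (cfc f S x) := h2
      rw [hx', map_zero] at h3
      exact h3)
    rcases hN with hN | hN
    · refine hg0 (ContinuousLinearMap.ext fun x => ?_)
      have : cfc g S x ∈ LinearMap.ker (cfc f S).toLinearMap :=
        congrArg (fun T : H →L[ℂ] H => T x) hfg
      rw [hN] at this
      simpa using this
    · refine hf0 (ContinuousLinearMap.ext fun x => ?_)
      have : x ∈ LinearMap.ker (cfc f S).toLinearMap := hN ▸ Submodule.mem_top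
      exact this
  · push Not at hsp
    obtain ⟨c, hc⟩ : (spectrum ℝ S).Nonempty := ContinuousFunctionalCalculus.spectrum_nonempty S hS
    refine ⟨c, ?_⟩
    have h1 : cfc (id : ℝ → ℝ) S = cfc (fun _ => c) S :=
      cfc_congr fun x hx => le_antisymm (hsp c hc x hx) (hsp x hx c hc)
    rw [cfc_id ℝ S, cfc_const c S] at h1
    rw [h1, Algebra.algebraMap_eq_smul_one]
    ext x
    simp

/-- Schur's lemma for a self-adjoint topologically irreducible set of operators. -/
theorem exists_eq_smul_one_of_commute {B : Set (H →L[ℂ] H)}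
    (hB : IsIrreducibleOperatorSet B) (hstar : ∀ b ∈ B, star b ∈ B) {S : H →L[ℂ] H}
    (hcomm : ∀ b ∈ B, Commute S b) : ∃ c : ℂ, S = c • 1 := by
  have hcomm' : ∀ b ∈ B, Commute (star S) b := fun b hb => by
    simpa using (hcomm _ (hstar b hb)).star_star
  obtain ⟨c, hc⟩ := (IsSelfAdjoint.add_star_self S).exists_eq_smul_one_of_commute hB
    fun b hb => (hcomm b hb).add_left (hcomm' b hb)
  have hsa : IsSelfAdjoint (Complex.I • (S - star S)) := by
    rw [IsSelfAdjoint, star_smul, star_sub, star_star, Complex.star_def, Complex.conj_I]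
    module
  obtain ⟨d, hd⟩ := hsa.exists_eq_smul_one_of_commute hB
    fun b hb => ((hcomm b hb).sub_left (hcomm' b hb)).smul_left _
  -- From `S + S* = c` and `i(S - S*) = d` one gets `2S = c - i d`.
  refine ⟨(c - Complex.I * d) / 2, ?_⟩
  have h2 : (2 : ℂ) • S = (S + star S) - Complex.I • (Complex.I • (S - star S)) := by
    rw [smul_smul, Complex.I_mul_I, two_smul]; module
  have h3 : S = (2⁻¹ : ℂ) • ((2 : ℂ) • S) := by rw [smul_smul]; norm_num
  rw [h3, h2, hc, hd]
  module

/-- A form of von Neumann's density theorem: a weakly continuous functional vanishing on a unital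
irreducible self-adjoint algebra of operators vanishes on all operators. -/
theorem sum_inner_eq_zero_of_irreducible {B : Subalgebra ℂ (H →L[ℂ] H)}
    (hB : IsIrreducibleOperatorSet (B : Set (H →L[ℂ] H))) (hstar : ∀ b ∈ B, star b ∈ B)
    {m : ℕ} (x y : Fin m → H) (h : ∀ b ∈ B, ∑ k, inner ℂ (y k) (b (x k)) = 0)
    (T : H →L[ℂ] H) : ∑ k, inner ℂ (y k) (T (x k)) = 0 := by
  let diag : (H →L[ℂ] H) → (PiLp 2 fun _ : Fin m => H) →L[ℂ] (PiLp 2 fun _ : Fin m => H) := fun T =>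
    ((PiLp.continuousLinearEquiv 2 ℂ fun _ : Fin m => H).symm :
        (Fin m → H) →L[ℂ] (PiLp 2 fun _ : Fin m => H)) ∘L
      (ContinuousLinearMap.pi fun k => T ∘L (PiLp.proj 2 (fun _ : Fin m => H) k))
  have diag_apply (T : H →L[ℂ] H) (z : PiLp 2 fun _ : Fin m => H) (k : Fin m) : diag T z k = T (z k) := rfl
  let X : PiLp 2 fun _ : Fin m => H := WithLp.toLp 2 x
  let Y : PiLp 2 fun _ : Fin m => H := WithLp.toLp 2 y
  have inner_E (z z' : PiLp 2 fun _ : Fin m => H) : inner ℂ z z' = ∑ k, inner ℂ (z k) (z' k) := PiLp.inner_apply _ _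
  let N₀ : Submodule ℂ (PiLp 2 fun _ : Fin m => H) :=
    { carrier := {z | ∃ b ∈ B, diag b X = z}
      zero_mem' := ⟨0, B.zero_mem, by ext k; simp [diag_apply]⟩
      add_mem' := by
        rintro _ _ ⟨b, hb, rfl⟩ ⟨b', hb', rfl⟩
        exact ⟨b + b', B.add_mem hb hb', by ext k; simp [diag_apply]⟩
      smul_mem' := by
        rintro c _ ⟨b, hb, rfl⟩
        exact ⟨c • b, B.smul_mem hb c, by ext k; simp [diag_apply]⟩ }
  -- `N` is the closure of `B X` in `H^m`. Its projection `P` commutes with the diagonal action of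
  -- `B`, so by Schur its matrix entries are scalars, and `P` commutes with the diagonal action of
  -- every `T`. Thus `T X` lies in `N`, to which `Y` is orthogonal.
  let N := N₀.topologicalClosure
  have hNinv : ∀ b ∈ B, ∀ z ∈ N, diag b z ∈ N := by
    intro b hb z hz
    have : Set.MapsTo (diag b) N₀ N₀ := by
      rintro _ ⟨b', hb', rfl⟩
      exact ⟨b * b', B.mul_mem hb hb', by ext k; simp [diag_apply]⟩
    exact this.closure (diag b).continuous hz
  have hXN : X ∈ N := N₀.le_topologicalClosure ⟨1, B.one_mem, by ext k; simp [diag_apply]⟩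
  have : CompleteSpace N := N₀.isClosed_topologicalClosure.completeSpace_coe
  let P : (PiLp 2 fun _ : Fin m => H) →L[ℂ] (PiLp 2 fun _ : Fin m => H) := N.starProjection
  have hPcomm : ∀ b ∈ B, ∀ z, P (diag b z) = diag b (P z) := by
    intro b hb z
    refine Submodule.eq_starProjection_of_mem_of_inner_eq_zero
      (hNinv b hb _ (Submodule.starProjection_apply_mem _ _)) fun w hw => ?_
    have h1 : inner ℂ (diag b z - diag b (P z)) w = inner ℂ (z - P z) (diag (star b) w) := by
      rw [← map_sub, inner_E, inner_E]
      refine Finset.sum_congr rfl fun k _ => ?_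
      rw [diag_apply, diag_apply, ContinuousLinearMap.star_eq_adjoint,
        ContinuousLinearMap.adjoint_inner_right]
    rw [h1]
    exact Submodule.starProjection_inner_eq_zero _ _ (hNinv _ (hstar b hb) w hw)
  let ι : Fin m → H →L[ℂ] (PiLp 2 fun _ : Fin m => H) := fun k =>
    ((PiLp.continuousLinearEquiv 2 ℂ fun _ : Fin m => H).symm :
        (Fin m → H) →L[ℂ] (PiLp 2 fun _ : Fin m => H)) ∘L (ContinuousLinearMap.single ℂ (fun _ : Fin m => H) k)
  have hι (k : Fin m) (z : H) : ι k z = WithLp.toLp 2 (Pi.single k z) := rfl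
  let Q : Fin m → Fin m → H →L[ℂ] H := fun j k =>
    (PiLp.proj 2 (fun _ : Fin m => H) j) ∘L P ∘L ι k
  have hQ (j k : Fin m) (z : H) : Q j k z = P (ι k z) j := rfl
  have hdι (T : H →L[ℂ] H) (k : Fin m) (z : H) : diag T (ι k z) = ι k (T z) := by
    ext j
    rw [diag_apply, hι, hι]
    rcases eq_or_ne j k with rfl | hjk
    · simp
    · simp [hjk]
  have hscalar (j k : Fin m) : ∃ c : ℂ, Q j k = c • 1 := by
    refine exists_eq_smul_one_of_commute hB hstar fun b hb => ?_
    ext z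
    change Q j k (b z) = b (Q j k z)
    rw [hQ, hQ, ← hdι, hPcomm b hb, diag_apply]
  choose c hc using hscalar
  have hsum (z : PiLp 2 fun _ : Fin m => H) : z = ∑ k, ι k (z k) := by
    ext j
    simp [hι]
  have hPapp (z : PiLp 2 fun _ : Fin m => H) (j : Fin m) : P z j = ∑ k, c j k • z k := by
    conv_lhs => rw [hsum z]
    rw [map_sum]
    have : (∑ k, P (ι k (z k))) j = ∑ k, P (ι k (z k)) j := by simp
    rw [this]
    refine Finset.sum_congr rfl fun k _ => ?_
    rw [← hQ, hc]
    simp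
  have hPT : P (diag T X) = diag T (P X) := by
    ext j
    rw [hPapp, diag_apply, hPapp, map_sum]
    simp [diag_apply]
  have hPX : P X = X := Submodule.starProjection_eq_self_iff.mpr hXN
  have hTN : diag T X ∈ N := by
    rw [hPX] at hPT
    exact Submodule.starProjection_eq_self_iff.mp hPT
  have hYN : ∀ z ∈ N, inner ℂ Y z = 0 := by
    intro z hz
    have hcl : IsClosed {z : PiLp 2 (fun _ : Fin m => H) | inner ℂ Y z = 0} :=
      isClosed_eq (by fun_prop) continuous_const
    have hsub : (N₀ : Set (PiLp 2 (fun _ : Fin m => H))) ⊆ {z : PiLp 2 (fun _ : Fin m => H) | inner ℂ Y z = 0} := by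
      rintro _ ⟨b, hb, rfl⟩
      exact (inner_E _ _).trans (h b hb)
    exact closure_minimal hsub hcl hz
  exact (inner_E _ _).symm.trans (hYN _ hTN)

theorem List.exists_prod_map_update {ι R : Type*} [DecidableEq ι] [Monoid R] (a : ι → R) (i : ι)
    (l : List ι) (hl : l.Nodup) (hi : i ∈ l) :
    ∃ p q : R, ∀ t : R, (l.map (Function.update a i t)).prod = p * t * q := by
  obtain ⟨l₁, l₂, rfl⟩ := List.append_of_mem hi
  refine ⟨(l₁.map a).prod, (l₂.map a).prod, fun t => ?_⟩
  have h : i ∉ l₁ ∧ i ∉ l₂ := by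
    have := (List.nodup_middle.mp hl)
    rw [List.nodup_cons, List.mem_append, not_or] at this
    exact this.1
  have hcongr (l : List ι) (hil : i ∉ l) : l.map (Function.update a i t) = l.map a :=
    List.map_congr_left fun j hj => Function.update_of_ne (ne_of_mem_of_not_mem hj hil) _ _
  simp [hcongr _ h.1, hcongr _ h.2, mul_assoc]

/-- As a function of one argument `t`, `S_r` is a sum of terms `± p t q`, so its matrix coefficients
are functionals of the kind covered by the density theorem. The arguments are freed from `B` one at
a time. -/
theorem standardPolynomial_eq_zero_of_irreducible {B : Subalgebra ℂ (H →L[ℂ] H)}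
    (hB : IsIrreducibleOperatorSet (B : Set (H →L[ℂ] H))) (hstar : ∀ b ∈ B, star b ∈ B) {r : ℕ}
    (h : ∀ a : Fin r → H →L[ℂ] H, (∀ i, a i ∈ B) → standardPolynomial r _ a = 0)
    (a : Fin r → H →L[ℂ] H) : standardPolynomial r _ a = 0 := by
  classical
  have step (a : Fin r → H →L[ℂ] H) (i : Fin r)
      (hb : ∀ b ∈ B, standardPolynomial r _ (Function.update a i b) = 0) (T : H →L[ℂ] H) :
      standardPolynomial r _ (Function.update a i T) = 0 := by
    have hdec (σ : Equiv.Perm (Fin r)) : ∃ p q : H →L[ℂ] H, ∀ t : H →L[ℂ] H,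
        (List.ofFn fun j => Function.update a i t (σ j)).prod = p * t * q := by
      obtain ⟨p, q, hpq⟩ := List.exists_prod_map_update a i (List.ofFn σ)
        (List.nodup_ofFn.mpr σ.injective) (List.mem_ofFn.mpr ⟨σ.symm i, by simp⟩)
      exact ⟨p, q, fun t => by rw [← hpq, List.map_ofFn]; rfl⟩
    choose p q hpq using hdec
    have hform (t : H →L[ℂ] H) (x y : H) :
        inner ℂ y (standardPolynomial r _ (Function.update a i t) x) =
          ∑ σ : Equiv.Perm (Fin r),
            inner ℂ (((Equiv.Perm.sign σ : ℤ) : ℂ) • star (p σ) y) (t (q σ x)) := by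
      rw [standardPolynomial_apply, sum_apply, inner_sum]
      refine Finset.sum_congr rfl fun σ _ => ?_
      rw [hpq, inner_smul_left, ContinuousLinearMap.star_eq_adjoint,
        ContinuousLinearMap.adjoint_inner_left, Units.smul_def, ← Int.cast_smul_eq_zsmul ℂ]
      simp [inner_smul_right]
    ext x
    refine ext_inner_left ℂ fun y => ?_
    let e := (Fintype.equivFin (Equiv.Perm (Fin r))).symm
    rw [hform, ← e.sum_comp, zero_apply, inner_zero_right]
    refine sum_inner_eq_zero_of_irreducible hB hstar (fun k => q (e k) x)
      (fun k => ((Equiv.Perm.sign (e k) : ℤ) : ℂ) • star (p (e k)) y) (fun b hbB => ?_) T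
    have h1 := hform b x y
    rw [hb b hbB, zero_apply, inner_zero_right, ← e.sum_comp] at h1
    exact h1.symm
  have key (s : Finset (Fin r)) : ∀ a : Fin r → H →L[ℂ] H, (∀ i ∉ s, a i ∈ B) →
      standardPolynomial r _ a = 0 := by
    induction s using Finset.induction_on with
    | empty => exact fun a ha => h a fun i => ha i (by simp)
    | insert i s his ih =>
      intro a ha
      have := step a i (fun b hb => ih _ fun j hj => ?_) (a i)
      · rwa [Function.update_eq_self] at this
      · rcases eq_or_ne j i with rfl | hji
        · simpa using hb
        · rw [Function.update_of_ne hji]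
          exact ha j (by simp [hji, hj])
  exact key Finset.univ a (by simp)

omit [CompleteSpace H] in
/-- If all operators on a Hilbert space satisfy a standard identity that fails in size `n + 1`,
the space has dimension at most `n`. -/
theorem rank_le_of_standardPolynomial_eq_zero {r n : ℕ} (hr : ¬ StandardIdentityEnd r (n + 1))
    (h : ∀ a : Fin r → H →L[ℂ] H, standardPolynomial r _ a = 0) : Module.rank ℂ H ≤ n := by
  by_contra hn
  obtain ⟨p, hp⟩ := exists_injective_of_lt_rank hn
  refine hr (standardIdentityEnd_of_comp p hp fun g => ?_)
  let p' : (Fin (n + 1) → ℂ) →L[ℂ] H := LinearMap.toContinuousLinearMap p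
  obtain ⟨q, hq⟩ : ∃ q : H →L[ℂ] (Fin (n + 1) → ℂ), ∀ x, q (p x) = x := by
    let e := LinearEquiv.ofInjective p hp
    have : FiniteDimensional ℂ (LinearMap.range p) := inferInstance
    let P : H →L[ℂ] LinearMap.range p := (LinearMap.range p).orthogonalProjectionOnto
    refine ⟨(LinearMap.toContinuousLinearMap e.symm.toLinearMap) ∘L P, fun x => ?_⟩
    have : P (p x) = e x :=
      Submodule.orthogonalProjectionOnto_mem_subspace_eq_self (e x)
    simp [this]
  let g' : Fin r → H →L[ℂ] H := fun i => p' ∘L (LinearMap.toContinuousLinearMap (g i)) ∘L q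
  refine ⟨fun i => (g' i).toLinearMap, fun i => ?_, ?_⟩
  · ext1 x
    refine LinearMap.ext fun c => ?_
    simp [g', p', hq]
  · have := congrArg (ContinuousLinearMap.toLinearMapRingHom (R₁ := ℂ) (M₁ := H)) (h g')
    rw [map_standardPolynomial, map_zero] at this
    exact this

/-- Elements of the Jacobson radical act by zero in a representation by operators whose image is
closed under adjoints. -/
theorem map_eq_zero_of_mem_jacobson {A : Type*} [Ring A] [Algebra ℂ A]
    (π : A →ₐ[ℂ] H →L[ℂ] H) (hπ : ∀ a, ∃ a', π a' = star (π a)) {x : A}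
    (hx : x ∈ Ideal.jacobson (⊥ : Ideal A)) : π x = 0 := by
  obtain ⟨x', hx'⟩ := hπ x
  let S := π (x' * x)
  have hS' : S = star (π x) * π x := by simp [S, hx']
  have hS : IsSelfAdjoint S := hS' ▸ IsSelfAdjoint.star_mul_self _
  have hunit (c : ℝ) : IsUnit (1 - (c : ℂ) • S) := by
    -- Quasi-regularity gives only a left inverse of `1 - cS`; as this operator is self-adjoint, the
    -- adjoint of that inverse is a right inverse. So the spectrum of `S = π(x)* π(x)` is at most
    -- `{0}`.
    obtain ⟨z, hz⟩ := Ideal.mem_jacobson_iff.mp hx (-(c : ℂ) • x')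
    rw [Ideal.mem_bot] at hz
    have h1 : π z * (1 - (c : ℂ) • S) = 1 := by
      have := congrArg π hz
      rw [map_sub, map_add, map_mul, map_mul, map_smul, map_one, map_zero] at this
      simp only [S, map_mul]
      rw [mul_sub, mul_one, mul_smul_comm, ← mul_assoc, ← sub_eq_zero, ← this]
      simp only [neg_smul, mul_neg, neg_mul, mul_smul_comm, smul_mul_assoc]
      abel
    have hsa : star (1 - (c : ℂ) • S) = 1 - (c : ℂ) • S := by
      rw [star_sub, star_one, star_smul, hS.star_eq]; simp
    have h2 : (1 - (c : ℂ) • S) * star (π z) = 1 := by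
      have := congrArg star h1
      rwa [star_mul, hsa, star_one] at this
    exact isUnit_iff_exists_and_exists.mpr ⟨⟨_, h2⟩, ⟨_, h1⟩⟩
  have hspec : spectrum ℂ S ⊆ {0} := by
    intro μ hμ
    have hre := hS.mem_spectrum_eq_re hμ
    by_contra h0
    have h0' : μ ≠ 0 := h0
    refine hμ ?_
    have h1 := hunit (μ.re)⁻¹
    have h2 : algebraMap ℂ (H →L[ℂ] H) μ - S =
        algebraMap ℂ (H →L[ℂ] H) μ * (1 - ((μ.re⁻¹ : ℝ) : ℂ) • S) := by
      rw [Complex.ofReal_inv, ← hre, mul_sub, mul_one, mul_smul_comm, ← Algebra.smul_def,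
        smul_smul, inv_mul_cancel₀ h0', one_smul]
    rw [spectrum.mem_resolventSet_iff, h2]
    exact ((IsUnit.mk0 μ h0').map (algebraMap ℂ (H →L[ℂ] H))).mul h1
  have hnorm : S = 0 := by
    have h1 := hS.spectralRadius_eq_nnnorm
    have h2 : spectralRadius ℂ S = 0 := by
      refine le_antisymm (iSup₂_le fun k hk => ?_) bot_le
      rw [Set.mem_singleton_iff.mp (hspec hk)]
      simp
    rw [h2] at h1
    simpa using h1.symm
  rw [hS'] at hnorm
  exact (CStarRing.star_mul_self_eq_zero_iff _).mp hnorm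

end Operators

open ComplexConjugate

/-! ### Invariant positive kernels on `G/K` and their extreme points -/

section Kernels

variable {G : Type*} [Group G] {K : Subgroup G}

/-- The sesquilinear form on `ℂ[X]` with matrix `k`. -/
noncomputable def kernelForm {X : Type*} (k : X → X → ℂ) (f f' : X →₀ ℂ) : ℂ :=
  f.sum fun x c => f'.sum fun y d => conj c * d * k x y

theorem kernelForm_add_left {X : Type*} (k : X → X → ℂ) (f₁ f₂ f' : X →₀ ℂ) :
    kernelForm k (f₁ + f₂) f' = kernelForm k f₁ f' + kernelForm k f₂ f' := by
  rw [kernelForm, Finsupp.sum_add_index']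
  · rfl
  · simp
  · intro x c d
    simp [add_mul]

theorem kernelForm_smul_left {X : Type*} (k : X → X → ℂ) (c : ℂ) (f f' : X →₀ ℂ) :
    kernelForm k (c • f) f' = conj c * kernelForm k f f' := by
  rw [kernelForm, Finsupp.sum_smul_index, kernelForm, Finsupp.mul_sum]
  · simp only [Finsupp.mul_sum, map_mul, mul_assoc]
  · simp

theorem kernelForm_single {X : Type*} (k : X → X → ℂ) (x y : X) (c d : ℂ) :
    kernelForm k (Finsupp.single x c) (Finsupp.single y d) = conj c * d * k x y := by
  simp [kernelForm]

theorem kernelForm_add_right {X : Type*} (k : X → X → ℂ) (f f₁ f₂ : X →₀ ℂ) :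
    kernelForm k f (f₁ + f₂) = kernelForm k f f₁ + kernelForm k f f₂ := by
  simp only [kernelForm, ← Finsupp.sum_add]
  refine Finsupp.sum_congr fun x _ => ?_
  rw [Finsupp.sum_add_index'] <;> simp [mul_add, add_mul]

theorem continuous_kernelForm {X : Type*} (f f' : X →₀ ℂ) :
    Continuous fun k : X → X → ℂ => kernelForm k f f' := by
  unfold kernelForm Finsupp.sum
  fun_prop

theorem kernelForm_inner {X V : Type*} [NormedAddCommGroup V] [InnerProductSpace ℂ V]
    (T : (X →₀ ℂ) →ₗ[ℂ] V) (f f' : X →₀ ℂ) :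
    kernelForm (fun x y => inner ℂ (T (Finsupp.single x 1)) (T (Finsupp.single y 1))) f f' =
      inner ℂ (T f) (T f') := by
  have h (f : X →₀ ℂ) : T f = f.sum fun x c => c • T (Finsupp.single x 1) := by
    conv_lhs => rw [← Finsupp.sum_single f, map_finsuppSum]
    refine Finsupp.sum_congr fun x _ => ?_
    rw [← map_smul, Finsupp.smul_single, smul_eq_mul, mul_one]
  rw [h f, h f']
  rw [kernelForm, Finsupp.sum, Finsupp.sum, sum_inner]
  refine Finset.sum_congr rfl fun x _ => ?_
  rw [Finsupp.sum, Finsupp.sum, inner_sum]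
  refine Finset.sum_congr rfl fun y _ => ?_
  rw [inner_smul_left, inner_smul_right, mul_assoc]

variable (K) in
/-- The normalized `G`-invariant positive semidefinite kernels on `G/K`. -/
structure IsPosKernel (k : G ⧸ K → G ⧸ K → ℂ) : Prop where
  smul_smul : ∀ (g : G) (x y : G ⧸ K), k (g • x) (g • y) = k x y
  conj_symm : ∀ x y, conj (k y x) = k x y
  re_nonneg : ∀ f : G ⧸ K →₀ ℂ, 0 ≤ (kernelForm k f f).re
  one_one : k ((1 : G) : G ⧸ K) ((1 : G) : G ⧸ K) = 1

theorem IsPosKernel.apply_self {k : G ⧸ K → G ⧸ K → ℂ} (hk : IsPosKernel K k) (x : G ⧸ K) :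
    k x x = 1 := by
  induction x using QuotientGroup.induction_on with
  | H g =>
    have := hk.smul_smul g ((1 : G) : G ⧸ K) ((1 : G) : G ⧸ K)
    rw [hk.one_one] at this
    simpa using this

theorem IsPosKernel.norm_le_one {k : G ⧸ K → G ⧸ K → ℂ} (hk : IsPosKernel K k) (x y : G ⧸ K) :
    ‖k x y‖ ≤ 1 := by
  -- The Cauchy–Schwarz test vector: on it the form equals `1 - ‖k x y‖²`.
  have h := hk.re_nonneg (Finsupp.single x 1 + Finsupp.single y (-conj (k x y)))
  have h2 : k y x = conj (k x y) := (hk.conj_symm y x).symm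
  rw [kernelForm_add_left, kernelForm_add_right, kernelForm_add_right, kernelForm_single,
    kernelForm_single, kernelForm_single, kernelForm_single, hk.apply_self, hk.apply_self, h2] at h
  have h3 : conj (k x y) * k x y = ((‖k x y‖ ^ 2 : ℝ) : ℂ) := by
    rw [mul_comm, Complex.mul_conj, Complex.normSq_eq_norm_sq]
  have h4 : (0 : ℝ) ≤ 1 - ‖k x y‖ ^ 2 := by
    have h5 : conj (1 : ℂ) * 1 * 1 + conj (1 : ℂ) * -conj (k x y) * k x y +
        (conj (-conj (k x y)) * 1 * conj (k x y) +
          conj (-conj (k x y)) * -conj (k x y) * 1) = ((1 - ‖k x y‖ ^ 2 : ℝ) : ℂ) := by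
      push_cast
      rw [← Complex.ofReal_pow, ← h3]
      simp
      ring
    rw [h5, Complex.ofReal_re] at h
    exact h
  nlinarith [norm_nonneg (k x y)]

variable (K) in
-- The conditions are closed for pointwise convergence, and the values lie in the unit disc, so
-- Tychonoff applies.
theorem isCompact_setOf_isPosKernel : IsCompact {k | IsPosKernel K k} := by
  have hsub : {k | IsPosKernel K k} ⊆
      Set.univ.pi fun _ : G ⧸ K => Set.univ.pi fun _ : G ⧸ K => Metric.closedBall (0 : ℂ) 1 := by
    intro k hk x _ y _
    simpa using hk.norm_le_one x y
  refine IsCompact.of_isClosed_subset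
    (isCompact_univ_pi fun _ => isCompact_univ_pi fun _ => isCompact_closedBall _ _) ?_ hsub
  have : {k : G ⧸ K → G ⧸ K → ℂ | IsPosKernel K k} =
      {k | ∀ (g : G) (x y : G ⧸ K), k (g • x) (g • y) = k x y} ∩ {k | ∀ x y, conj (k y x) = k x y} ∩
        {k | ∀ f : G ⧸ K →₀ ℂ, 0 ≤ (kernelForm k f f).re} ∩
        {k | k ((1 : G) : G ⧸ K) ((1 : G) : G ⧸ K) = 1} := by
    ext k
    exact ⟨fun h => ⟨⟨⟨h.1, h.2⟩, h.3⟩, h.4⟩, fun h => ⟨h.1.1.1, h.1.1.2, h.1.2, h.2⟩⟩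
  rw [this]
  refine (((?_ : IsClosed _).inter ?_).inter ?_).inter ?_
  · simp only [Set.ofPred_forall]
    exact isClosed_iInter fun g => isClosed_iInter fun x => isClosed_iInter fun y =>
      isClosed_eq (by fun_prop) (by fun_prop)
  · simp only [Set.ofPred_forall]
    exact isClosed_iInter fun x => isClosed_iInter fun y =>
      isClosed_eq (Complex.continuous_conj.comp (by fun_prop)) (by fun_prop)
  · simp only [Set.ofPred_forall]
    exact isClosed_iInter fun f =>
      isClosed_le continuous_const (Complex.continuous_re.comp (continuous_kernelForm f f))
  · exact isClosed_eq (by fun_prop) (by fun_prop)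

open Classical in
/-- The identity kernel. -/
noncomputable def diagonalKernel (X : Type*) (x y : X) : ℂ := if x = y then 1 else 0

theorem kernelForm_diagonalKernel {X : Type*} (f : X →₀ ℂ) :
    kernelForm (diagonalKernel X) f f = ((∑ x ∈ f.support, ‖f x‖ ^ 2 : ℝ) : ℂ) := by
  rw [kernelForm, Finsupp.sum, Complex.ofReal_sum]
  refine Finset.sum_congr rfl fun x hx => ?_
  rw [Finsupp.sum, Finset.sum_eq_single x]
  · rw [mul_comm (conj (f x)), diagonalKernel, if_pos rfl, mul_one, Complex.mul_conj, Complex.normSq_eq_norm_sq]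
  · intro y _ hyx
    rw [diagonalKernel, if_neg hyx.symm, mul_zero]
  · intro h
    exact absurd hx h

variable (K) in
theorem isPosKernel_diagonalKernel : IsPosKernel K (diagonalKernel (G ⧸ K)) where
  smul_smul g x y := by
    rcases eq_or_ne x y with rfl | hxy
    · simp [diagonalKernel]
    · rw [diagonalKernel, diagonalKernel, if_neg hxy, if_neg ((MulAction.injective g).ne hxy)]
  conj_symm x y := by simp [diagonalKernel, eq_comm, apply_ite]
  re_nonneg f := by
    rw [kernelForm_diagonalKernel, Complex.ofReal_re]
    positivity
  one_one := by simp [diagonalKernel]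

/-- Every nonzero `f` is detected by an extreme normalized positive kernel. -/
theorem exists_extreme_kernel {f : G ⧸ K →₀ ℂ} (hf : f ≠ 0) :
    ∃ k ∈ Set.extremePoints ℝ {k | IsPosKernel K k}, kernelForm k f f ≠ 0 := by
  classical
  let S := {k | IsPosKernel K k}
  have hS : IsCompact S := isCompact_setOf_isPosKernel K
  let ℓ : StrongDual ℝ (G ⧸ K → G ⧸ K → ℂ) :=
    { toFun := fun k => (kernelForm k f f).re
      map_add' := fun k k' => by
        rw [← Complex.add_re]
        congr 1
        simp only [kernelForm, ← Finsupp.sum_add, Pi.add_apply, mul_add]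
      map_smul' := fun c k => by
        simp only [kernelForm, Finsupp.sum, Pi.smul_apply, Complex.real_smul, RingHom.id_apply,
          smul_eq_mul]
        rw [← Complex.re_ofReal_mul, Finset.mul_sum]
        congr 1
        refine Finset.sum_congr rfl fun x _ => ?_
        rw [Finset.mul_sum]
        exact Finset.sum_congr rfl fun y _ => by ring
      cont := Complex.continuous_re.comp (continuous_kernelForm f f) }
  obtain ⟨k₁, hk₁, hmax⟩ := hS.exists_isMaxOn ⟨_, isPosKernel_diagonalKernel K⟩ ℓ.continuous.continuousOn
  -- The face where `ℓ` is maximal is compact, so it has an extreme point, which is extreme in `S`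
  -- too. There `ℓ` is at least its value at the diagonal kernel, the squared `ℓ²` norm of `f`,
  -- which is positive.
  have hexp : IsExposed ℝ S {k ∈ S | ∀ k' ∈ S, ℓ k' ≤ ℓ k} := fun _ => ⟨ℓ, rfl⟩
  have hcpt := hexp.isCompact hS
  obtain ⟨k, hk⟩ := hcpt.extremePoints_nonempty ⟨k₁, hk₁, fun k' hk' => hmax hk'⟩
  refine ⟨k, hexp.isExtreme.extremePoints_subset_extremePoints hk, fun h0 => ?_⟩
  have h1 := hk.1.2 _ (isPosKernel_diagonalKernel K)
  have h2 : ℓ k = 0 := by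
    change (kernelForm k f f).re = 0
    rw [h0, Complex.zero_re]
  rw [h2] at h1
  change (kernelForm _ f f).re ≤ 0 at h1
  rw [kernelForm_diagonalKernel, Complex.ofReal_re] at h1
  obtain ⟨x, hx⟩ := Finsupp.support_nonempty_iff.mpr hf
  have h3 : 0 < ∑ x ∈ f.support, ‖f x‖ ^ 2 :=
    Finset.sum_pos (fun x hx => by
      have := norm_pos_iff.mpr (Finsupp.mem_support_iff.mp hx)
      positivity) ⟨x, hx⟩
  linarith

end Kernels

/-! ### The GNS representation of a positive kernel -/

section GNS

variable {G : Type u} [Group G] {K : Subgroup G}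

theorem kernelForm_cosetRep {k : G ⧸ K → G ⧸ K → ℂ} (hk : IsPosKernel K k) (g : G)
    (f f' : G ⧸ K →₀ ℂ) :
    kernelForm k (cosetRep K g f) (cosetRep K g f') = kernelForm k f f' := by
  change kernelForm k (Finsupp.mapDomain (g • ·) f) (Finsupp.mapDomain (g • ·) f') = _
  rw [kernelForm, Finsupp.sum_mapDomain_index_inj (MulAction.injective g)]
  simp only [Finsupp.sum_mapDomain_index_inj (MulAction.injective g), hk.smul_smul]
  rfl

/-- The Gelfand–Naimark–Segal construction for a normalized invariant positive kernel. -/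
theorem IsPosKernel.exists_representation {k : G ⧸ K → G ⧸ K → ℂ} (hk : IsPosKernel K k) :
    ∃ (V : Type u) (_ : NormedAddCommGroup V) (_ : InnerProductSpace ℂ V) (_ : CompleteSpace V)
      (ρ : Representation ℂ G V) (v : V),
      (∀ (g : G) (x y : V), inner ℂ (ρ g x) (ρ g y) = inner ℂ x y) ∧ v ∈ fixedVectors ρ K ∧
      (∀ f f' : G ⧸ K →₀ ℂ, inner ℂ (orbitMap ρ v f) (orbitMap ρ v f') = kernelForm k f f') ∧
      DenseRange (orbitMap ρ v : (G ⧸ K →₀ ℂ) → V) := by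
  let core : PreInnerProductSpace.Core ℂ (G ⧸ K →₀ ℂ) :=
    { inner := kernelForm k
      conj_inner_symm := fun f f' => by
        simp only [kernelForm, Finsupp.sum, map_sum, map_mul, hk.conj_symm, Complex.conj_conj]
        rw [Finset.sum_comm]
        exact Finset.sum_congr rfl fun x _ => Finset.sum_congr rfl fun y _ => by ring
      re_inner_nonneg := hk.re_nonneg
      add_left := kernelForm_add_left k
      smul_left := fun f f' c => kernelForm_smul_left k c f f' }
  let _ : SeminormedAddCommGroup (G ⧸ K →₀ ℂ) :=
    InnerProductSpace.Core.toSeminormedAddCommGroup (𝕜 := ℂ)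
  let _ : InnerProductSpace ℂ (G ⧸ K →₀ ℂ) := InnerProductSpace.ofCore core
  have inner_eq (f f' : G ⧸ K →₀ ℂ) : inner ℂ f f' = kernelForm k f f' := rfl
  have hnorm (g : G) (f : G ⧸ K →₀ ℂ) : ‖cosetRep K g f‖ ≤ 1 * ‖f‖ := by
    rw [one_mul, ← sq_le_sq₀ (norm_nonneg _) (norm_nonneg _), @norm_sq_eq_re_inner ℂ,
      @norm_sq_eq_re_inner ℂ, inner_eq, inner_eq, kernelForm_cosetRep hk]
  let τ : G → (G ⧸ K →₀ ℂ) →L[ℂ] (G ⧸ K →₀ ℂ) := fun g => (cosetRep K g).mkContinuous 1 (hnorm g)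
  have hτ (g : G) (f : G ⧸ K →₀ ℂ) : τ g f = cosetRep K g f := rfl
  -- This completion is also separated, so null vectors of the form need not be divided out
  -- beforehand.
  let V := UniformSpace.Completion (G ⧸ K →₀ ℂ)
  let σ : G → V →L[ℂ] V := fun g => (τ g).completion
  have hσ (g : G) (f : G ⧸ K →₀ ℂ) : σ g (f : V) = ((cosetRep K g f : G ⧸ K →₀ ℂ) : V) := by
    rw [← hτ]
    exact ContinuousLinearMap.completion_apply_coe (τ g) f
  let ρ : Representation ℂ G V :=
    { toFun := fun g => (σ g).toLinearMap
      map_one' := by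
        refine LinearMap.ext fun x => ?_
        refine UniformSpace.Completion.induction_on x
          (isClosed_eq (σ 1).continuous continuous_id) fun f => ?_
        exact (hσ 1 f).trans (by simp)
      map_mul' := fun g h => by
        refine LinearMap.ext fun x => ?_
        refine UniformSpace.Completion.induction_on x
          (isClosed_eq (σ (g * h)).continuous ((σ g).continuous.comp (σ h).continuous))
          fun f => ?_
        change σ (g * h) f = σ g (σ h f)
        rw [hσ, hσ, hσ]
        simp }
  have hρ (g : G) (f : G ⧸ K →₀ ℂ) : ρ g (f : V) = ((cosetRep K g f : G ⧸ K →₀ ℂ) : V) := hσ g f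
  have hfix : ((baseVector K : G ⧸ K →₀ ℂ) : V) ∈ fixedVectors ρ K := fun g hg => by
    rw [hρ, baseVector_mem_fixedVectors g hg]
  let ι : (G ⧸ K →₀ ℂ) →ₗ[ℂ] V :=
    (UniformSpace.Completion.toComplL : (G ⧸ K →₀ ℂ) →L[ℂ] V).toLinearMap
  have hι (f : G ⧸ K →₀ ℂ) : orbitMap ρ ((baseVector K : G ⧸ K →₀ ℂ) : V) f = (f : V) :=
    (congrArg (fun T => T f) (eq_orbitMap (ρ := ρ) ι fun g x => (hρ g x).symm)).symm
  refine ⟨V, inferInstance, inferInstance, inferInstance, ρ, ((baseVector K : G ⧸ K →₀ ℂ) : V),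
    fun g x y => ?_, hfix, fun f f' => ?_, ?_⟩
  · refine UniformSpace.Completion.induction_on₂ x y
      (isClosed_eq (((σ g).continuous.comp continuous_fst).inner
        ((σ g).continuous.comp continuous_snd)) (continuous_fst.inner continuous_snd)) fun f f' => ?_
    rw [hρ, hρ, UniformSpace.Completion.inner_coe, UniformSpace.Completion.inner_coe, inner_eq,
      inner_eq, kernelForm_cosetRep hk]
  · rw [hι, hι, UniformSpace.Completion.inner_coe, inner_eq]
  · have : (orbitMap ρ ((baseVector K : G ⧸ K →₀ ℂ) : V) : (G ⧸ K →₀ ℂ) → V) =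
        UniformSpace.Completion.coe' := funext hι
    rw [this]
    exact UniformSpace.Completion.denseRange_coe

end GNS

/-! ### Extreme kernels give irreducible unitary representations -/

section Unitary

variable {G : Type*} [Group G] {K : Subgroup G} {V : Type*} [NormedAddCommGroup V]
  [InnerProductSpace ℂ V] {ρ : Representation ℂ G V}

theorem inner_self_eq_ofReal_norm_sq (x : V) : inner ℂ x x = ((‖x‖ ^ 2 : ℝ) : ℂ) := by
  rw [inner_self_eq_norm_sq_to_K, Complex.ofReal_pow]
  rfl

theorem norm_map_of_inner_map_map
    (h : ∀ (g : G) (x y : V), inner ℂ (ρ g x) (ρ g y) = inner ℂ x y) (g : G) (x : V) :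
    ‖ρ g x‖ = ‖x‖ := by
  rw [← sq_eq_sq₀ (norm_nonneg _) (norm_nonneg _), @norm_sq_eq_re_inner ℂ,
    @norm_sq_eq_re_inner ℂ, h]

theorem inner_map_left
    (h : ∀ (g : G) (x y : V), inner ℂ (ρ g x) (ρ g y) = inner ℂ x y) (g : G) (x y : V) :
    inner ℂ (ρ g x) y = inner ℂ x (ρ g⁻¹ y) := by
  rw [← h g x (ρ g⁻¹ y)]
  simp

/-- Vectors in the dense image of `ℂ[G/K]` have open stabilizers and the action is isometric, so an
`ε/3` argument gives joint continuity. -/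
theorem isUnitaryRep_of_denseRange_orbitMap [TopologicalSpace G] [IsTopologicalGroup G]
    (hK : IsOpen (K : Set G)) (h : ∀ (g : G) (x y : V), inner ℂ (ρ g x) (ρ g y) = inner ℂ x y)
    {v : V} (hv : v ∈ fixedVectors ρ K)
    (hd : DenseRange (orbitMap ρ v : (G ⧸ K →₀ ℂ) → V)) : IsUnitaryRep ρ := by
  refine ⟨?_, h⟩
  rw [continuous_iff_continuousAt]
  rintro ⟨g₀, x₀⟩
  rw [Metric.continuousAt_iff']
  intro ε hε
  obtain ⟨f, hf⟩ := hd.exists_dist_lt x₀ (by positivity : 0 < ε / 3)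
  have hopen : ∀ᶠ g in nhds g₀, cosetRep K (g₀⁻¹ * g) f = f := by
    have h1 := (isSmoothRep_cosetRep hK f).preimage (continuous_const_mul g₀⁻¹)
    exact h1.mem_nhds (by simp)
  have hball : ∀ᶠ x in nhds x₀, dist x x₀ < ε / 3 := Metric.ball_mem_nhds _ (by positivity)
  rw [nhds_prod_eq]
  filter_upwards [hopen.prod_mk hball] with ⟨g, x⟩ ⟨hg, hx⟩
  simp only at hg hx ⊢
  have hgf : ρ g (orbitMap ρ v f) = ρ g₀ (orbitMap ρ v f) := by
    rw [← orbitMap_cosetRep hv, ← orbitMap_cosetRep hv]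
    conv_rhs => rw [← hg, ← Module.End.mul_apply, ← map_mul, mul_inv_cancel_left]
  have hdist (g : G) (x y : V) : dist (ρ g x) (ρ g y) = dist x y := by
    rw [dist_eq_norm, dist_eq_norm, ← map_sub, norm_map_of_inner_map_map h]
  calc dist (ρ g x) (ρ g₀ x₀) ≤ dist (ρ g x) (ρ g x₀) +
        (dist (ρ g x₀) (ρ g (orbitMap ρ v f)) + dist (ρ g (orbitMap ρ v f)) (ρ g₀ x₀)) :=
        (dist_triangle _ _ _).trans (by gcongr; exact dist_triangle _ _ _)
    _ = dist x x₀ + (dist x₀ (orbitMap ρ v f) + dist x₀ (orbitMap ρ v f)) := by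
        rw [hdist, hdist, hgf, hdist, dist_comm (orbitMap ρ v f)]
    _ < ε := by linarith

theorem isPosKernel_orbitMap (h : ∀ (g : G) (x y : V), inner ℂ (ρ g x) (ρ g y) = inner ℂ x y)
    {v : V} (hv : v ∈ fixedVectors ρ K) {c : ℝ} (hc : c * ‖v‖ ^ 2 = 1) (hc0 : 0 ≤ c) :
    IsPosKernel K fun x y => (c : ℂ) *
      inner ℂ (orbitMap ρ v (Finsupp.single x 1)) (orbitMap ρ v (Finsupp.single y 1)) where
  smul_smul g x y := by
    rw [← cosetRep_single, ← cosetRep_single, orbitMap_cosetRep hv, orbitMap_cosetRep hv, h]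
  conj_symm x y := by simp
  re_nonneg f := by
    have : kernelForm (fun x y => (c : ℂ) *
        inner ℂ (orbitMap ρ v (Finsupp.single x 1)) (orbitMap ρ v (Finsupp.single y 1))) f f =
        (c : ℂ) * inner ℂ (orbitMap ρ v f) (orbitMap ρ v f) := by
      rw [← kernelForm_inner]
      simp only [kernelForm, Finsupp.mul_sum]
      refine Finsupp.sum_congr fun x _ => Finsupp.sum_congr fun y _ => by ring
    rw [this, Complex.re_ofReal_mul]
    exact mul_nonneg hc0 (inner_self_nonneg (𝕜 := ℂ))
  one_one := by
    change (c : ℂ) * inner ℂ (orbitMap ρ v (baseVector K)) (orbitMap ρ v (baseVector K)) = 1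
    rw [orbitMap_baseVector hv, inner_self_eq_ofReal_norm_sq]
    exact_mod_cast hc

theorem starProjection_map [CompleteSpace V]
    (h : ∀ (g : G) (x y : V), inner ℂ (ρ g x) (ρ g y) = inner ℂ x y) (W : Submodule ℂ V)
    [W.HasOrthogonalProjection] (hW : ∀ g, ∀ x ∈ W, ρ g x ∈ W) (g : G) (x : V) :
    W.starProjection (ρ g x) = ρ g (W.starProjection x) := by
  refine Submodule.eq_starProjection_of_mem_of_inner_eq_zero
    (hW g _ (Submodule.starProjection_apply_mem _ _)) fun w hw => ?_
  rw [← map_sub, inner_map_left h]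
  exact Submodule.starProjection_inner_eq_zero _ _ (hW _ _ hw)

/-- A closed invariant subspace with projection `P` splits `k` into a convex combination of the
normalized kernels of `P v` and `v - P v`. Extremality and cyclicity of `v` make `P` a scalar, hence
`0` or `1`. -/
theorem isTopologicallyIrreducible_of_extreme [CompleteSpace V]
    (h : ∀ (g : G) (x y : V), inner ℂ (ρ g x) (ρ g y) = inner ℂ x y)
    {v : V} (hv : v ∈ fixedVectors ρ K) (hd : DenseRange (orbitMap ρ v : (G ⧸ K →₀ ℂ) → V))
    {k : G ⧸ K → G ⧸ K → ℂ} (hk : k ∈ Set.extremePoints ℝ {k | IsPosKernel K k})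
    (hkv : ∀ f f' : G ⧸ K →₀ ℂ, inner ℂ (orbitMap ρ v f) (orbitMap ρ v f') = kernelForm k f f') :
    IsTopologicallyIrreducible ρ := by
  have hv1 : ‖v‖ ^ 2 = 1 := by
    have h1 := hkv (baseVector K) (baseVector K)
    rw [orbitMap_baseVector hv, baseVector, kernelForm_single, hk.1.one_one,
      inner_self_eq_ofReal_norm_sq] at h1
    simp only [map_one, mul_one] at h1
    exact_mod_cast h1
  have hv0 : v ≠ 0 := by
    rintro rfl
    simp at hv1
  refine ⟨⟨v, 0, hv0⟩, fun W hWc => ?_⟩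
  have hWc' : IsClosed (W.toSubmodule : Set V) := hWc
  have : CompleteSpace W.toSubmodule := hWc'.completeSpace_coe
  let P : V →L[ℂ] V := W.toSubmodule.starProjection
  have hP (g : G) (x : V) : P (ρ g x) = ρ g (P x) :=
    starProjection_map h W.toSubmodule (fun g x hx => W.apply_mem_toSubmodule g hx) g x
  have hPfix : P v ∈ fixedVectors ρ K := fun g hg => by rw [← hP, hv g hg]
  have hQfix : v - P v ∈ fixedVectors ρ K := Submodule.sub_mem _ hv hPfix
  have hPorb (f : G ⧸ K →₀ ℂ) : orbitMap ρ (P v) f = P (orbitMap ρ v f) := by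
    have h1 := eq_orbitMap (K := K) (ρ := ρ) (P.toLinearMap ∘ₗ orbitMap ρ v) fun g x => by
      simp [orbitMap_cosetRep hv, hP]
    have h2 := congrArg (fun T => T f) h1
    simpa [orbitMap_baseVector hv] using h2.symm
  have hQorb (f : G ⧸ K →₀ ℂ) : orbitMap ρ (v - P v) f = orbitMap ρ v f - P (orbitMap ρ v f) := by
    have h1 := orbitMap_add ρ (v - P v) (P v) f
    rw [sub_add_cancel, hPorb] at h1
    exact eq_sub_of_add_eq h1.symm
  have horth (x y : V) : inner ℂ (x - P x) (P y) = 0 :=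
    Submodule.starProjection_inner_eq_zero _ _ (Submodule.starProjection_apply_mem _ _)
  have horth' (x y : V) : inner ℂ (P x) (y - P y) = 0 := by
    rw [← inner_conj_symm, horth, map_zero]
  have hsplit (x y : V) :
      inner ℂ x y = inner ℂ (P x) (P y) + inner ℂ (x - P x) (y - P y) := by
    conv_lhs => rw [← add_sub_cancel (P x) x, ← add_sub_cancel (P y) y]
    rw [inner_add_left, inner_add_right, inner_add_right, horth, horth']
    ring
  have hext (T : V →L[ℂ] V) (hT : ∀ f : G ⧸ K →₀ ℂ, T (orbitMap ρ v f) = 0) (x : V) : T x = 0 :=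
    congrFun (hd.equalizer T.continuous (continuous_const (y := (0 : V))) (funext hT)) x
  by_cases h0 : P v = 0
  · left
    have hPx := hext P fun f => by
      rw [← hPorb, h0]; simp [orbitMap, Finsupp.linearCombination_apply]
    refine Subrepresentation.toSubmodule_injective ((Submodule.eq_bot_iff _).mpr fun x hx => ?_)
    rw [← hPx x]
    exact (Submodule.starProjection_eq_self_iff.mpr hx).symm
  by_cases h1 : v - P v = 0
  · right
    have hPx := hext (1 - P) fun f => by
      change orbitMap ρ v f - P (orbitMap ρ v f) = 0
      rw [← hQorb, h1]; simp [orbitMap, Finsupp.linearCombination_apply]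
    refine Subrepresentation.toSubmodule_injective (Submodule.eq_top_iff'.mpr fun x => ?_)
    exact Submodule.starProjection_eq_self_iff.mp (sub_eq_zero.mp (hPx x)).symm
  exfalso
  have hp1 : 0 < ‖P v‖ ^ 2 := by have := norm_pos_iff.mpr h0; positivity
  have hp2 : 0 < ‖v - P v‖ ^ 2 := by have := norm_pos_iff.mpr h1; positivity
  have hsum : ‖P v‖ ^ 2 + ‖v - P v‖ ^ 2 = 1 := by
    have h2 := hsplit v v
    rw [inner_self_eq_ofReal_norm_sq, inner_self_eq_ofReal_norm_sq, inner_self_eq_ofReal_norm_sq] at h2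
    rw [← hv1]
    exact_mod_cast h2.symm
  have hk1 := isPosKernel_orbitMap h hPfix (c := (‖P v‖ ^ 2)⁻¹) (inv_mul_cancel₀ hp1.ne')
    (by positivity)
  have hk2 := isPosKernel_orbitMap h hQfix (c := (‖v - P v‖ ^ 2)⁻¹) (inv_mul_cancel₀ hp2.ne')
    (by positivity)
  -- Extremality identifies the normalized kernel of `P v` with `k`, which makes `P` equal to the
  -- scalar `‖P v‖²`. Idempotence would then give `‖P v‖² = 1`, although `‖v - P v‖² > 0`.
  have heq := hk.2 hk1 hk2 ⟨‖P v‖ ^ 2, ‖v - P v‖ ^ 2, hp1, hp2, hsum, by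
    funext x y
    simp only [Pi.add_apply, Pi.smul_apply, Complex.real_smul]
    rw [← mul_assoc, ← mul_assoc, ← Complex.ofReal_mul, ← Complex.ofReal_mul,
      mul_inv_cancel₀ hp1.ne', mul_inv_cancel₀ hp2.ne', Complex.ofReal_one, one_mul, one_mul,
      hPorb, hPorb, hQorb, hQorb, ← hsplit, hkv, kernelForm_single]
    simp⟩
  have hform (f f' : G ⧸ K →₀ ℂ) : inner ℂ (orbitMap ρ v f)
      (P (orbitMap ρ v f') - ((‖P v‖ ^ 2 : ℝ) : ℂ) • orbitMap ρ v f') = 0 := by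
    have h2 : inner ℂ (P (orbitMap ρ v f)) (P (orbitMap ρ v f')) =
        ((‖P v‖ ^ 2 : ℝ) : ℂ) * inner ℂ (orbitMap ρ v f) (orbitMap ρ v f') := by
      rw [hkv, ← heq, ← hPorb, ← hPorb, ← kernelForm_inner]
      simp only [kernelForm, Finsupp.mul_sum]
      refine Finsupp.sum_congr fun x _ => Finsupp.sum_congr fun y _ => ?_
      have h3 : ((‖P v‖ ^ 2 : ℝ) : ℂ) * (((‖P v‖ ^ 2)⁻¹ : ℝ) : ℂ) = 1 := by
        rw [← Complex.ofReal_mul, mul_inv_cancel₀ hp1.ne', Complex.ofReal_one]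
      linear_combination (-(conj (f x) * f' y * inner ℂ (orbitMap ρ (P v) (Finsupp.single x 1))
        (orbitMap ρ (P v) (Finsupp.single y 1)))) * h3
    have h4 : inner ℂ (orbitMap ρ v f) (P (orbitMap ρ v f')) =
        inner ℂ (P (orbitMap ρ v f)) (P (orbitMap ρ v f')) := by
      rw [← sub_eq_zero, ← inner_sub_left, horth]
    rw [inner_sub_right, inner_smul_right, h4, h2, sub_self]
  have hPt (f : G ⧸ K →₀ ℂ) : (P - ((‖P v‖ ^ 2 : ℝ) : ℂ) • (1 : V →L[ℂ] V)) (orbitMap ρ v f) = 0 :=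
    hd.eq_zero_of_inner_right ℂ fun f' => hform f' f
  have hPP := hext _ hPt (P v)
  have hidem : P (P v) = P v :=
    Submodule.starProjection_eq_self_iff.mpr (Submodule.starProjection_apply_mem _ _)
  change P (P v) - ((‖P v‖ ^ 2 : ℝ) : ℂ) • P v = 0 at hPP
  rw [hidem, ← one_smul ℂ (P v), smul_smul, ← sub_smul, smul_eq_zero] at hPP
  rcases hPP with hPP | hPP
  · have : (1 : ℝ) - ‖P v‖ ^ 2 = 0 := by
      simp only [one_smul, mul_one] at hPP
      exact_mod_cast hPP
    linarith
  · exact h0 hPP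

end Unitary

/-- A form of the Gelfand–Raikov theorem: every nonzero element of `ℂ[G/K]` acts by a nonzero map
on the `K`-fixed vectors of some irreducible unitary representation. -/
theorem exists_irreducible_orbitMap_ne_zero {G : Type u} [Group G] [TopologicalSpace G]
    [IsTopologicalGroup G] {K : Subgroup G} (hK : IsOpen (K : Set G)) {f : G ⧸ K →₀ ℂ}
    (hf : f ≠ 0) :
    ∃ (V : Type u) (_ : NormedAddCommGroup V) (_ : InnerProductSpace ℂ V) (_ : CompleteSpace V)
      (ρ : Representation ℂ G V), IsUnitaryRep ρ ∧ IsTopologicallyIrreducible ρ ∧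
      ∃ v ∈ fixedVectors ρ K, orbitMap ρ v f ≠ 0 := by
  obtain ⟨k, hk, hkf⟩ := exists_extreme_kernel hf
  obtain ⟨V, _, _, _, ρ, v, h, hv, hkv, hd⟩ := hk.1.exists_representation
  refine ⟨V, _, _, ‹_›, ρ, isUnitaryRep_of_denseRange_orbitMap hK h hv hd,
    isTopologicallyIrreducible_of_extreme h hv hd hk hkv, v, hv, fun h0 => hkf ?_⟩
  rw [← hkv, h0, inner_zero_left]

/-- A unitary representation with a `K`-fixed vector on which `ℂ[G/K]` acts faithfully. -/
theorem exists_unitaryRep_orbitMap_injective {G : Type u} [Group G] [TopologicalSpace G]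
    [IsTopologicalGroup G] {K : Subgroup G} (hK : IsOpen (K : Set G)) :
    ∃ (V : Type u) (_ : NormedAddCommGroup V) (_ : InnerProductSpace ℂ V) (_ : CompleteSpace V)
      (ρ : Representation ℂ G V), IsUnitaryRep ρ ∧
      ∃ v ∈ fixedVectors ρ K, ∀ f : G ⧸ K →₀ ℂ, orbitMap ρ v f = 0 → f = 0 := by
  classical
  -- The diagonal kernel yields `ℓ²(G/K)`, where the form on `ℂ[G/K]` is definite.
  obtain ⟨V, _, _, _, ρ, v, h, hv, hkv, hd⟩ := (isPosKernel_diagonalKernel K).exists_representation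
  refine ⟨V, _, _, ‹_›, ρ, isUnitaryRep_of_denseRange_orbitMap hK h hv hd, v, hv, fun f hf => ?_⟩
  have h1 := hkv f f
  rw [hf, inner_zero_left, kernelForm_diagonalKernel] at h1
  have h2 : ∑ x ∈ f.support, ‖f x‖ ^ 2 = 0 := by exact_mod_cast h1.symm
  rw [Finset.sum_eq_zero_iff_of_nonneg (fun _ _ => by positivity)] at h2
  by_contra hne
  obtain ⟨x, hx⟩ := Finsupp.support_nonempty_iff.mpr hne
  exact Finsupp.mem_support_iff.mp hx (by simpa using h2 x hx)

/-! ### Averaging into the Hecke algebra -/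

section HeckeAverage

variable {G : Type*} [Group G] [TopologicalSpace G] [IsTopologicalGroup G] {K : Subgroup G}

/-- The projection of a vector of `ℂ[G/K]` to the Hecke algebra by averaging over `K`. -/
theorem HeckeAlgebra.exists_average (hKc : IsCompact (K : Set G)) (hKo : IsOpen (K : Set G))
    (f : G ⧸ K →₀ ℂ) :
    ∃ (a : HeckeAlgebra K) (n : ℕ) (t : Fin n → G), n ≠ 0 ∧ (∀ i, t i ∈ K) ∧
      toVector a = (n : ℂ)⁻¹ • ∑ i, cosetRep K (t i) f := by
  obtain ⟨n, t, hn, ht, hf⟩ := _root_.exists_average hKc (isSmoothRep_cosetRep hKo) {f}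
  obtain ⟨a, ha⟩ := exists_toVector_eq (Submodule.smul_mem _ (n : ℂ)⁻¹ (hf f (by simp)))
  exact ⟨a, n, t, hn, ht, ha⟩

/-- A `K`-fixed vector generated by a `K`-fixed vector `v` lies in the Hecke module of `v`. -/
theorem HeckeAlgebra.exists_orbitMap_eq (hKc : IsCompact (K : Set G)) (hKo : IsOpen (K : Set G))
    {V : Type*} [AddCommGroup V] [Module ℂ V] {ρ : Representation ℂ G V} {v : V}
    (hv : v ∈ fixedVectors ρ K) {f : G ⧸ K →₀ ℂ} (hf : orbitMap ρ v f ∈ fixedVectors ρ K) :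
    ∃ a : HeckeAlgebra K, orbitMap ρ v (toVector a) = orbitMap ρ v f := by
  obtain ⟨a, n, t, hn, ht, ha⟩ := exists_average hKc hKo f
  refine ⟨a, ?_⟩
  rw [ha, map_smul, map_sum, Finset.sum_congr rfl fun i _ => by
    rw [orbitMap_cosetRep hv, hf _ (ht i)]]
  rw [Finset.sum_const, Finset.card_univ, Fintype.card_fin, ← Nat.cast_smul_eq_nsmul ℂ, smul_smul,
    inv_mul_cancel₀ (Nat.cast_ne_zero.mpr hn), one_smul]

end HeckeAverage

/-! ### The Hecke action on a unitary representation: adjoints and irreducibility -/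

section UnitaryHecke

variable {G : Type*} [Group G] [TopologicalSpace G] [IsTopologicalGroup G] {K : Subgroup G}
  {V : Type*} [NormedAddCommGroup V] [InnerProductSpace ℂ V] {ρ : Representation ℂ G V}

omit [IsTopologicalGroup G] in
theorem IsUnitaryRep.continuous_apply (hρ : IsUnitaryRep ρ) (g : G) :
    Continuous fun x => ρ g x :=
  hρ.continuous_action.comp (by fun_prop : Continuous fun x : V => (g, x))

omit [IsTopologicalGroup G] in
theorem IsUnitaryRep.isClosed_fixedVectors (hρ : IsUnitaryRep ρ) :
    IsClosed (fixedVectors ρ K : Set V) := by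
  have : (fixedVectors ρ K : Set V) = ⋂ g ∈ K, {x | ρ g x = x} := by
    ext x
    simp [fixedVectors]
  rw [this]
  exact isClosed_biInter fun g _ => isClosed_eq (hρ.continuous_apply g) continuous_id

omit [IsTopologicalGroup G] in
theorem IsUnitaryRep.continuous_orbitMap (hρ : IsUnitaryRep ρ) (f : G ⧸ K →₀ ℂ) :
    Continuous fun v => orbitMap ρ v f := by
  simp only [orbitMap, Finsupp.linearCombination_apply, Finsupp.sum]
  exact continuous_finsetSum _ fun x _ => (hρ.continuous_apply _).const_smul _

omit [IsTopologicalGroup G] in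
/-- The action of the Hecke algebra on fixed vectors of a unitary representation by bounded
operators. -/
noncomputable def IsUnitaryRep.heckeAction (hρ : IsUnitaryRep ρ) :
    HeckeAlgebra K →ₐ[ℂ] (fixedVectors ρ K →L[ℂ] fixedVectors ρ K) where
  toFun a := ⟨HeckeAlgebra.action ρ a, Continuous.subtype_mk
    ((hρ.continuous_orbitMap _).comp continuous_subtype_val) _⟩
  map_one' := ContinuousLinearMap.coe_injective (map_one (HeckeAlgebra.action ρ))
  map_mul' a b := ContinuousLinearMap.coe_injective (map_mul (HeckeAlgebra.action ρ) a b)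
  map_zero' := ContinuousLinearMap.coe_injective (map_zero (HeckeAlgebra.action ρ))
  map_add' a b := ContinuousLinearMap.coe_injective (map_add (HeckeAlgebra.action ρ) a b)
  commutes' c := ContinuousLinearMap.coe_injective
    (AlgHomClass.commutes (HeckeAlgebra.action (K := K) ρ) c)

omit [IsTopologicalGroup G] in
theorem IsUnitaryRep.coe_heckeAction (hρ : IsUnitaryRep ρ) (a : HeckeAlgebra K)
    (v : fixedVectors ρ K) : (hρ.heckeAction a v : V) = orbitMap ρ v.1 a.toVector := rfl

omit [IsTopologicalGroup G] in
-- Translating by `K` does not change the pairing with a `K`-fixed vector, so averaging realizes the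
-- compression to `V^K`.
theorem IsUnitaryRep.inner_average (hρ : IsUnitaryRep ρ) {u v : V} (hu : u ∈ fixedVectors ρ K)
    (hv : v ∈ fixedVectors ρ K) {a : HeckeAlgebra K} {f : G ⧸ K →₀ ℂ} {n : ℕ} {t : Fin n → G}
    (hn : n ≠ 0) (ht : ∀ i, t i ∈ K)
    (ha : a.toVector = (n : ℂ)⁻¹ • ∑ i, cosetRep K (t i) f) :
    inner ℂ u (orbitMap ρ v a.toVector) = inner ℂ u (orbitMap ρ v f) := by
  have h (i : Fin n) : inner ℂ u (orbitMap ρ v (cosetRep K (t i) f)) =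
      inner ℂ u (orbitMap ρ v f) := by
    rw [orbitMap_cosetRep hv]
    conv_lhs => rw [← hu _ (ht i), hρ.inner_map_map]
  rw [ha, map_smul, map_sum, inner_smul_right, inner_sum, Finset.sum_congr rfl fun i _ => h i,
    Finset.sum_const, Finset.card_univ, Fintype.card_fin, nsmul_eq_mul, ← mul_assoc,
    inv_mul_cancel₀ (Nat.cast_ne_zero.mpr hn), one_mul]

theorem IsUnitaryRep.exists_heckeAction_eq_star (hρ : IsUnitaryRep ρ)
    [CompleteSpace (fixedVectors ρ K)] (hKc : IsCompact (K : Set G))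
    (hKo : IsOpen (K : Set G)) (a : HeckeAlgebra K) :
    ∃ a' : HeckeAlgebra K, hρ.heckeAction a' = star (hρ.heckeAction a) := by
  -- The adjoint of `∑ c ρ(g)` is `∑ c̄ ρ(g⁻¹)`. It need not preserve `V^K`; averaging over `K`
  -- compresses it to `V^K`.
  let f' : G ⧸ K →₀ ℂ :=
    a.toVector.sum fun x c => Finsupp.single (((x.out)⁻¹ : G) : G ⧸ K) (conj c)
  obtain ⟨a', n, t, hn, ht, ha'⟩ := HeckeAlgebra.exists_average hKc hKo f'
  refine ⟨a', ?_⟩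
  rw [ContinuousLinearMap.star_eq_adjoint, ContinuousLinearMap.eq_adjoint_iff]
  intro w v
  rw [Submodule.coe_inner, Submodule.coe_inner, hρ.coe_heckeAction, hρ.coe_heckeAction,
    ← inner_conj_symm, hρ.inner_average v.2 w.2 hn ht ha', inner_conj_symm]
  simp only [f', Finsupp.sum, map_sum, orbitMap_single w.2, sum_inner, inner_smul_left,
    Complex.conj_conj]
  conv_rhs => rw [orbitMap, Finsupp.linearCombination_apply, Finsupp.sum, inner_sum]
  refine Finset.sum_congr rfl fun x _ => ?_
  rw [inner_smul_right, inner_map_left hρ.inner_map_map, inv_inv]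

/-- A nonzero `v` in `N` generates a dense subspace of `V`. Projecting its elements to `V^K` amounts
to applying Hecke operators to `v`, so the projections stay in `N` and are dense in `V^K`. -/
theorem IsUnitaryRep.isIrreducibleOperatorSet_range_heckeAction [CompleteSpace V]
    (hρ : IsUnitaryRep ρ) (hirr : IsTopologicallyIrreducible ρ) (hKc : IsCompact (K : Set G))
    (hKo : IsOpen (K : Set G)) :
    IsIrreducibleOperatorSet (hρ.heckeAction (K := K)).range.carrier := by
  intro N hN hinv
  refine or_iff_not_imp_left.mpr fun hbot => ?_
  obtain ⟨v, hvN, hv0⟩ := (Submodule.ne_bot_iff _).mp hbot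
  have hv0' : (v : V) ≠ 0 := fun h => hv0 (Subtype.ext h)
  let W : Subrepresentation ρ :=
    { toSubmodule := (LinearMap.range (orbitMap (K := K) ρ (v : V))).topologicalClosure
      apply_mem_toSubmodule := fun g x hx => by
        have : Set.MapsTo (ρ g) (LinearMap.range (orbitMap (K := K) ρ (v : V)))
            (LinearMap.range (orbitMap (K := K) ρ (v : V))) := by
          rintro _ ⟨f, rfl⟩
          exact ⟨cosetRep K g f, orbitMap_cosetRep v.2 g f⟩
        exact this.closure (hρ.continuous_apply g) hx }
  have hW : W = ⊤ := by
    refine (hirr.eq_bot_or_eq_top W (Submodule.isClosed_topologicalClosure _)).resolve_left ?_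
    intro h
    have h1 : (v : V) ∈ W.toSubmodule :=
      Submodule.le_topologicalClosure _ ⟨baseVector K, orbitMap_baseVector v.2⟩
    rw [h] at h1
    exact hv0' ((Submodule.mem_bot ℂ).mp h1)
  have hfc := hρ.isClosed_fixedVectors (K := K)
  have : CompleteSpace (fixedVectors ρ K) := hfc.completeSpace_coe
  let P : V →L[ℂ] fixedVectors ρ K := (fixedVectors ρ K).orthogonalProjectionOnto
  have hP (f : G ⧸ K →₀ ℂ) : P (orbitMap ρ (v : V) f) ∈ N := by
    obtain ⟨a, n, t, hn, ht, ha⟩ := HeckeAlgebra.exists_average hKc hKo f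
    have : P (orbitMap ρ (v : V) f) = hρ.heckeAction a v := by
      refine ext_inner_left ℂ fun u => ?_
      rw [Submodule.coe_inner, Submodule.coe_inner, hρ.coe_heckeAction,
        hρ.inner_average u.2 v.2 hn ht ha]
      exact (Submodule.inner_orthogonalProjectionOnto_eq_of_mem_left u _)
    rw [this]
    exact hinv _ ⟨a, rfl⟩ v hvN
  rw [Submodule.eq_top_iff']
  intro w
  have hw : (w : V) ∈ W.toSubmodule := by rw [hW]; exact Submodule.mem_top
  have hPw : P (w : V) = w := Submodule.orthogonalProjectionOnto_mem_subspace_eq_self w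
  rw [← hPw]
  have hmaps : Set.MapsTo P (LinearMap.range (orbitMap (K := K) ρ (v : V))) N := by
    rintro _ ⟨f, rfl⟩
    exact hP f
  have := hmaps.closure P.continuous hw
  rwa [hN.closure_eq] at this

end UnitaryHecke

/-! ### Maximal left ideals and irreducible smooth quotients of `ℂ[G/K]` -/

section SmoothQuotients

variable {G : Type u} [Group G] {K : Subgroup G}

theorem orbitMap_mem_of_invariant {N : Submodule ℂ (G ⧸ K →₀ ℂ)}
    (hN : ∀ g, ∀ x ∈ N, cosetRep K g x ∈ N) {m : G ⧸ K →₀ ℂ} (hm : m ∈ N) (f : G ⧸ K →₀ ℂ) :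
    orbitMap (cosetRep K) m f ∈ N := by
  rw [orbitMap, Finsupp.linearCombination_apply]
  exact Submodule.sum_mem _ fun x _ => N.smul_mem _ (hN _ _ hm)

theorem eq_top_of_baseVector_mem {N : Submodule ℂ (G ⧸ K →₀ ℂ)}
    (hN : ∀ g, ∀ x ∈ N, cosetRep K g x ∈ N) (h : baseVector K ∈ N) : N = ⊤ := by
  rw [Submodule.eq_top_iff']
  intro f
  induction f using coset_induction with
  | zero => exact N.zero_mem
  | add x y hx hy => exact N.add_mem hx hy
  | smul c g => exact N.smul_mem _ (hN _ _ h)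

/-- A proper subrepresentation of `ℂ[G/K]` is contained in a maximal one. -/
theorem exists_maximal_invariant {N₀ : Submodule ℂ (G ⧸ K →₀ ℂ)}
    (h₀ : ∀ g, ∀ x ∈ N₀, cosetRep K g x ∈ N₀) (hb : baseVector K ∉ N₀) :
    ∃ N, N₀ ≤ N ∧ Maximal (fun N : Submodule ℂ (G ⧸ K →₀ ℂ) =>
      (∀ g, ∀ x ∈ N, cosetRep K g x ∈ N) ∧ baseVector K ∉ N) N := by
  refine zorn_le_nonempty₀ {N : Submodule ℂ (G ⧸ K →₀ ℂ) |
      (∀ g, ∀ x ∈ N, cosetRep K g x ∈ N) ∧ baseVector K ∉ N} (fun c hc hchain y hy => ?_) N₀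
    ⟨h₀, hb⟩
  have hmem (x : G ⧸ K →₀ ℂ) : x ∈ sSup c ↔ ∃ N ∈ c, x ∈ N :=
    Submodule.mem_sSup_of_directed ⟨y, hy⟩ hchain.directedOn
  refine ⟨sSup c, ⟨fun g x hx => ?_, fun h => ?_⟩, fun N hN => le_sSup hN⟩
  · obtain ⟨N, hN, hxN⟩ := (hmem x).mp hx
    exact (hmem _).mpr ⟨N, hN, (hc hN).1 g x hxN⟩
  · obtain ⟨N, hN, hxN⟩ := (hmem _).mp h
    exact (hc hN).2 hxN

/-- The quotient of `ℂ[G/K]` by an invariant subspace. -/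
noncomputable def quotientRep (N : Submodule ℂ (G ⧸ K →₀ ℂ))
    (hN : ∀ g, ∀ x ∈ N, cosetRep K g x ∈ N) : Representation ℂ G ((G ⧸ K →₀ ℂ) ⧸ N) where
  toFun g := N.mapQ N (cosetRep K g) fun x hx => hN g x hx
  map_one' := by ext; simp
  map_mul' g h := by ext; simp

theorem quotientRep_mk {N : Submodule ℂ (G ⧸ K →₀ ℂ)} (hN : ∀ g, ∀ x ∈ N, cosetRep K g x ∈ N)
    (g : G) (f : G ⧸ K →₀ ℂ) : quotientRep N hN g (N.mkQ f) = N.mkQ (cosetRep K g f) := rfl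

theorem isIrreducible_quotientRep {N : Submodule ℂ (G ⧸ K →₀ ℂ)}
    (hN : Maximal (fun N : Submodule ℂ (G ⧸ K →₀ ℂ) =>
      (∀ g, ∀ x ∈ N, cosetRep K g x ∈ N) ∧ baseVector K ∉ N) N) :
    (quotientRep N hN.prop.1).IsIrreducible where
  exists_pair_ne := by
    refine ⟨⊥, ⊤, fun h => hN.prop.2 ?_⟩
    have h1 : N.mkQ (baseVector K) ∈ (⊤ : Subrepresentation (quotientRep N hN.prop.1)) :=
      Submodule.mem_top (R := ℂ)
    rw [← h] at h1
    exact (Submodule.Quotient.mk_eq_zero N).mp ((Submodule.mem_bot ℂ).mp h1)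
  eq_bot_or_eq_top S := by
    let N' : Submodule ℂ (G ⧸ K →₀ ℂ) := S.toSubmodule.comap N.mkQ
    have hN' : ∀ g, ∀ x ∈ N', cosetRep K g x ∈ N' := fun g x hx => by
      have := S.apply_mem_toSubmodule g hx
      rwa [quotientRep_mk] at this
    have hle : N ≤ N' := fun x hx => by
      have : N.mkQ x = 0 := (Submodule.Quotient.mk_eq_zero N).mpr hx
      change N.mkQ x ∈ S.toSubmodule
      rw [this]
      exact S.toSubmodule.zero_mem
    by_cases hb : baseVector K ∈ N'
    · right
      have htop := eq_top_of_baseVector_mem hN' hb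
      refine Subrepresentation.toSubmodule_injective (Submodule.eq_top_iff'.mpr fun x => ?_)
      obtain ⟨f, rfl⟩ := N.mkQ_surjective x
      exact (htop ▸ Submodule.mem_top : f ∈ N')
    · left
      have hle' := hN.le_of_ge ⟨hN', hb⟩ hle
      refine Subrepresentation.toSubmodule_injective ((Submodule.eq_bot_iff _).mpr fun x hx => ?_)
      obtain ⟨f, rfl⟩ := N.mkQ_surjective x
      exact (Submodule.Quotient.mk_eq_zero N).mpr (hle' hx)

namespace HeckeAlgebra

/-- The subrepresentation of `ℂ[G/K]` generated by a left ideal of the Hecke algebra. -/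
noncomputable def idealSpan (L : Ideal (HeckeAlgebra K)) : Submodule ℂ (G ⧸ K →₀ ℂ) :=
  ⨆ l : L, LinearMap.range l.1.unop.1

theorem cosetRep_mem_idealSpan (L : Ideal (HeckeAlgebra K)) (g : G) (x : G ⧸ K →₀ ℂ)
    (hx : x ∈ idealSpan L) : cosetRep K g x ∈ idealSpan L := by
  refine Submodule.iSup_induction _ (motive := fun x => cosetRep K g x ∈ idealSpan L) hx
    (fun l x hx => ?_) (by simp) (fun x y hx hy => by rw [map_add]; exact Submodule.add_mem _ hx hy)
  obtain ⟨f, rfl⟩ := hx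
  exact Submodule.mem_iSup_of_mem l ⟨cosetRep K g f, unop_cosetRep _ _ _⟩

variable [TopologicalSpace G] [IsTopologicalGroup G]

/-- Averaging over `K` carries an expression of the base vector in the span of `L` to one inside
`L`, but only rescales the base vector; so `1` would lie in `L`. -/
theorem baseVector_notMem_idealSpan (hKc : IsCompact (K : Set G)) (hKo : IsOpen (K : Set G))
    {L : Ideal (HeckeAlgebra K)} (hL : L ≠ ⊤) : baseVector K ∉ idealSpan L := by
  classical
  intro h
  -- `F` collects the vectors `f` in an expression `∑ l(f)`. A tuple that makes all of `F` fixed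
  -- turns each `f` into a Hecke element `a`, and `l(f)` into the product `a * l` of the left ideal.
  have key : ∃ F : Finset (G ⧸ K →₀ ℂ), ∀ (n : ℕ) (t : Fin n → G),
      (∀ v ∈ F, ∑ i, cosetRep K (t i) v ∈ fixedVectors (cosetRep K) K) →
      ∃ l ∈ L, toVector l = ∑ i, cosetRep K (t i) (baseVector K) := by
    refine Submodule.iSup_induction _ (motive := fun x => ∃ F : Finset (G ⧸ K →₀ ℂ),
      ∀ (n : ℕ) (t : Fin n → G),
      (∀ v ∈ F, ∑ i, cosetRep K (t i) v ∈ fixedVectors (cosetRep K) K) →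
      ∃ l ∈ L, toVector l = ∑ i, cosetRep K (t i) x) h ?_ ?_ ?_
    · rintro l _ ⟨f, rfl⟩
      refine ⟨{f}, fun n t ht => ?_⟩
      obtain ⟨a, ha⟩ := exists_toVector_eq (ht f (by simp))
      refine ⟨a * l.1, L.mul_mem_left a l.2, ?_⟩
      rw [toVector_mul, ← unop_eq_orbitMap, ha, map_sum]
      exact Finset.sum_congr rfl fun i _ => unop_cosetRep _ _ _
    · exact ⟨∅, fun n t _ => ⟨0, L.zero_mem, by simp⟩⟩
    · rintro x y ⟨F, hF⟩ ⟨F', hF'⟩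
      refine ⟨F ∪ F', fun n t ht => ?_⟩
      obtain ⟨l, hl, hlx⟩ := hF n t fun v hv => ht v (Finset.mem_union_left _ hv)
      obtain ⟨l', hl', hly⟩ := hF' n t fun v hv => ht v (Finset.mem_union_right _ hv)
      exact ⟨l + l', L.add_mem hl hl', by
        rw [map_add, hlx, hly, ← Finset.sum_add_distrib]
        exact Finset.sum_congr rfl fun i _ => (map_add _ _ _).symm⟩
  obtain ⟨F, hF⟩ := key
  obtain ⟨n, t, hn, ht, hfix⟩ := _root_.exists_average hKc (isSmoothRep_cosetRep hKo) F
  obtain ⟨l, hl, hlv⟩ := hF n t hfix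
  have h1 : l = (n : ℂ) • (1 : HeckeAlgebra K) := by
    refine toVector_injective ?_
    rw [hlv, Finset.sum_congr rfl fun i _ => baseVector_mem_fixedVectors _ (ht i),
      Finset.sum_const, Finset.card_univ, Fintype.card_fin, map_smul, Nat.cast_smul_eq_nsmul]
    rfl
  have h2 : (1 : HeckeAlgebra K) = algebraMap ℂ (HeckeAlgebra K) (n : ℂ)⁻¹ * l := by
    rw [h1, ← Algebra.smul_def, smul_smul, inv_mul_cancel₀ (Nat.cast_ne_zero.mpr hn), one_smul]
  exact hL ((Ideal.eq_top_iff_one L).mpr (h2 ▸ L.mul_mem_left _ hl))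

/-- Every maximal left ideal of the Hecke algebra is the annihilator of a `K`-fixed vector in an
irreducible smooth representation. -/
theorem exists_irreducible_of_isMaximal (hKc : IsCompact (K : Set G)) (hKo : IsOpen (K : Set G))
    {L : Ideal (HeckeAlgebra K)} (hL : L.IsMaximal) :
    ∃ (W : Type u) (_ : AddCommGroup W) (_ : Module ℂ W) (ρ : Representation ℂ G W),
      IsSmoothRep ρ ∧ ρ.IsIrreducible ∧ ∃ w ∈ fixedVectors ρ K, ∀ a : HeckeAlgebra K,
        orbitMap ρ w (toVector a) = 0 → a ∈ L := by
  obtain ⟨N, hLN, hN⟩ := exists_maximal_invariant (cosetRep_mem_idealSpan L)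
    (baseVector_notMem_idealSpan hKc hKo hL.ne_top)
  have hmk : ∀ g x, N.mkQ (cosetRep K g x) = quotientRep N hN.prop.1 g (N.mkQ x) :=
    fun g x => rfl
  refine ⟨(G ⧸ K →₀ ℂ) ⧸ N, inferInstance, inferInstance, quotientRep N hN.prop.1, ?_,
    isIrreducible_quotientRep hN, N.mkQ (baseVector K),
    intertwining_mem_fixedVectors _ hmk baseVector_mem_fixedVectors, fun a ha => ?_⟩
  · intro x
    obtain ⟨f, rfl⟩ := N.mkQ_surjective x
    let S : Subgroup G :=
      { carrier := {g | quotientRep N hN.prop.1 g (N.mkQ f) = N.mkQ f}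
        one_mem' := by simp
        mul_mem' := fun {a b} ha hb => by
          simp only [Set.mem_ofPred_eq] at *
          rw [map_mul, Module.End.mul_apply, hb, ha]
        inv_mem' := fun {a} ha => by
          simp only [Set.mem_ofPred_eq] at *
          conv_lhs => rw [← ha]
          rw [← Module.End.mul_apply, ← map_mul, inv_mul_cancel, map_one, Module.End.one_apply] }
    have h1 := isSmoothRep_cosetRep hKo f
    refine Subgroup.isOpen_of_mem_nhds S (g := 1) (Filter.mem_of_superset (h1.mem_nhds (by simp))
      fun g hg => ?_)
    change quotientRep N hN.prop.1 g (N.mkQ f) = N.mkQ f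
    rw [quotientRep_mk, show cosetRep K g f = f from hg]
  · rw [← eq_orbitMap _ hmk] at ha
    have haN : toVector a ∈ N := (Submodule.Quotient.mk_eq_zero N).mp ha
    -- `J` is a proper left ideal containing `L`, hence equal to `L` by maximality.
    let J : Ideal (HeckeAlgebra K) :=
      { carrier := {a | toVector a ∈ N}
        zero_mem' := by simp
        add_mem' := fun {a b} ha hb => by
          simp only [Set.mem_ofPred_eq] at *
          rw [map_add]
          exact N.add_mem ha hb
        smul_mem' := fun b a ha => by
          simp only [Set.mem_ofPred_eq, smul_eq_mul] at *
          rw [toVector_mul]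
          exact orbitMap_mem_of_invariant hN.prop.1 ha _ }
    have hJ : J ≠ ⊤ := fun h => hN.prop.2 ((Ideal.eq_top_iff_one J).mp h)
    have hLJ : L ≤ J := fun l hl =>
      hLN (Submodule.mem_iSup_of_mem (⟨l, hl⟩ : L) ⟨baseVector K, rfl⟩)
    rw [hL.eq_of_le hJ hLJ]
    exact haN

end HeckeAlgebra

end SmoothQuotients

/-! ### Schur's lemma and Jacobson density below the continuum -/

section Schur

open Polynomial in
/-- An endomorphism of a nonzero complex vector space of dimension less than the continuum has
nonempty spectrum. -/
theorem spectrum_nonempty_of_rank_lt_continuum {V : Type*} [AddCommGroup V] [Module ℂ V]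
    [Nontrivial V] (h : Module.rank ℂ V < Cardinal.continuum) (d : Module.End ℂ V) :
    (spectrum ℂ d).Nonempty := by
  by_contra hne
  rw [Set.not_nonempty_iff_eq_empty] at hne
  have hunit (p : ℂ[X]) (hp : p ≠ 0) : IsUnit (aeval d p) := by
    rw [(IsAlgClosed.splits p).eq_prod_roots, map_mul, aeval_C]
    refine IsUnit.mul ((IsUnit.mk0 _ (leadingCoeff_ne_zero.mpr hp)).map _) ?_
    by_contra hnu
    obtain ⟨c, hc, -⟩ := spectrum.exists_mem_of_not_isUnit_aeval_prod hnu
    rw [hne] at hc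
    exact hc
  have hinv (c : ℂ) : ∃ e : Module.End ℂ V, aeval d (X - C c) * e = 1 := by
    obtain ⟨e, he⟩ := hunit (X - C c) (X_sub_C_ne_zero c)
    exact ⟨(e⁻¹ : (Module.End ℂ V)ˣ), by rw [← he, Units.mul_inv]⟩
  choose e he using hinv
  obtain ⟨v, hv⟩ := exists_ne (0 : V)
  -- With empty spectrum every nonzero polynomial in `d` is invertible. Clearing denominators in a
  -- relation among the vectors `(d - c)⁻¹ v` gives `q(d) v = 0` with `q ≠ 0`, so these continuum
  -- many vectors are independent.
  have hli : LinearIndependent ℂ fun c : ℂ => e c v := by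
    classical
    refine linearIndependent_iff'.mpr fun s m hm i hi => ?_
    by_contra hmi
    let q : ℂ[X] := ∑ j ∈ s, C (m j) * ∏ l ∈ s.erase j, (X - C l)
    have hq : q.eval i ≠ 0 := by
      rw [eval_finsetSum, Finset.sum_eq_single i]
      · rw [eval_mul, eval_C, eval_prod]
        refine mul_ne_zero hmi (Finset.prod_ne_zero_iff.mpr fun l hl => ?_)
        rw [eval_sub, eval_X, eval_C, sub_ne_zero]
        exact (Finset.ne_of_mem_erase hl).symm
      · intro j hj hji
        rw [eval_mul, eval_prod, Finset.prod_eq_zero (i := i)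
          (Finset.mem_erase.mpr ⟨hji.symm, hi⟩) (by simp), mul_zero]
      · exact fun h => absurd hi h
    have hq0 : q ≠ 0 := fun h => hq (by rw [h, eval_zero])
    have hqv : aeval d q v = 0 := by
      have h1 := congrArg (aeval d (∏ l ∈ s, (X - C l))) hm
      rw [map_zero, map_sum] at h1
      rw [← h1, map_sum, LinearMap.sum_apply]
      refine Finset.sum_congr rfl fun j hj => ?_
      have h3 : aeval d (X - C j) (e j v) = v := by
        rw [← Module.End.mul_apply, he, Module.End.one_apply]
      rw [map_smul, ← Finset.prod_erase_mul s _ hj, map_mul, map_mul,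
        Module.End.mul_apply (aeval d (∏ l ∈ s.erase j, (X - C l))) (aeval d (X - C j)), h3,
        aeval_C, Module.End.mul_apply, Module.algebraMap_end_apply]
    obtain ⟨t, ht⟩ := hunit q hq0
    refine hv ?_
    have h2 : ((t⁻¹ : (Module.End ℂ V)ˣ) : Module.End ℂ V) (aeval d q v) = v := by
      rw [← ht, ← Module.End.mul_apply, Units.inv_mul, Module.End.one_apply]
    rw [← h2, hqv, map_zero]
  have hle := hli.cardinal_lift_le_rank
  rw [Cardinal.mk_complex, Cardinal.lift_continuum, Cardinal.lift_uzero] at hle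
  exact absurd hle (not_le.mpr h)

/-- Schur's lemma and Jacobson density for a simple module of dimension less than the continuum:
a standard identity of the algebra bounds the dimension of the module. -/
theorem rank_le_of_isSimple {A V : Type*} [Ring A] [Algebra ℂ A] [AddCommGroup V] [Module ℂ V]
    (π : A →ₐ[ℂ] Module.End ℂ V) (hπ : ∀ v w : V, v ≠ 0 → ∃ a, π a v = w)
    (hcard : Module.rank ℂ V < Cardinal.continuum) {r n : ℕ}
    (hr : ¬ StandardIdentityEnd r (n + 1)) (hA : ∀ a : Fin r → A, standardPolynomial r A a = 0) :
    Module.rank ℂ V ≤ n := by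
  classical
  by_contra hn
  obtain ⟨p, hp⟩ := exists_injective_of_lt_rank hn
  have hV : Nontrivial V := hp.nontrivial
  let _ : Module A V := Module.compHom V (π : A →+* Module.End ℂ V)
  have smul_def (a : A) (v : V) : a • v = π a v := rfl
  have algebraMap_smul' (c : ℂ) (v : V) : algebraMap ℂ A c • v = c • v := by
    rw [smul_def, AlgHom.commutes, Module.algebraMap_end_apply]
  have : IsSimpleModule A V :=
    isSimpleModule_iff_toSpanSingleton_surjective.mpr ⟨hV, fun v hv w => hπ v w hv⟩
  have hscalar (f : Module.End A V) : ∃ c : ℂ, ∀ v, f v = c • v := by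
    let d : Module.End ℂ V :=
      { toFun := f
        map_add' := f.map_add
        map_smul' := fun c v => by
          rw [← algebraMap_smul', map_smul, algebraMap_smul', RingHom.id_apply] }
    obtain ⟨c, hc⟩ := spectrum_nonempty_of_rank_lt_continuum hcard d
    let f' : Module.End A V :=
      { toFun := fun v => c • v - f v
        map_add' := fun v w => by rw [smul_add, map_add]; abel
        map_smul' := fun a v => by
          rw [map_smul, RingHom.id_apply, smul_sub, smul_def, smul_def, ← map_smul]
          rfl }
    refine ⟨c, ?_⟩
    rcases f'.bijective_or_eq_zero with hb | h0
    · refine absurd ((Module.End.isUnit_iff _).mpr ?_) hc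
      have : ⇑(algebraMap ℂ (Module.End ℂ V) c - d) = f' := by
        ext v
        rfl
      rw [this]
      exact hb
    · intro v
      have : c • v - f v = 0 := congrArg (fun T => T v) h0
      exact (sub_eq_zero.mp this).symm
  refine hr (standardIdentityEnd_of_comp p hp fun g => ?_)
  obtain ⟨q, hq⟩ := p.exists_leftInverse_of_injective (LinearMap.ker_eq_bot.mpr hp)
  have hq' (x : Fin (n + 1) → ℂ) : q (p x) = x := congrArg (fun T => T x) hq
  have hdense (i : Fin r) : ∃ a : A, ∀ j : Fin (n + 1),
      p (g i (Pi.single j 1)) = π a (p (Pi.single j 1)) := by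
    -- As the commutant is `ℂ`, every complex-linear operator commutes with it, so density provides
    -- an element of `A` that agrees with `g i` on the embedded basis.
    let F : Module.End (Module.End A V) V :=
      { toFun := fun v => p (g i (q v))
        map_add' := fun v w => by simp
        map_smul' := fun f v => by
          obtain ⟨c, hc⟩ := hscalar f
          simp only [Module.End.smul_def, hc, map_smul, RingHom.id_apply] }
    obtain ⟨a, ha⟩ := jacobson_density F
      (Finset.univ.image fun j : Fin (n + 1) => p (Pi.single j 1))
    refine ⟨a, fun j => ?_⟩
    have := ha (p (Pi.single j 1)) (by simp)
    rw [← smul_def, ← this]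
    change _ = p (g i (q (p (Pi.single j 1))))
    rw [hq']
  choose a ha using hdense
  refine ⟨fun i => π (a i), fun i => ?_, ?_⟩
  · ext j
    simpa using ha i j
  · rw [← map_standardPolynomial, hA, map_zero]

end Schur

/-! ### Fixed vectors of irreducible smooth representations -/

section Irreducible

variable {G : Type u} [Group G] {K : Subgroup G}

theorem orbitMap_surjective_of_isIrreducible {V : Type*} [AddCommGroup V] [Module ℂ V]
    {ρ : Representation ℂ G V} (hρ : ρ.IsIrreducible) {v : V} (hv : v ∈ fixedVectors ρ K)
    (hv0 : v ≠ 0) : Function.Surjective (orbitMap (K := K) ρ v) := by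
  let W : Subrepresentation ρ :=
    { toSubmodule := LinearMap.range (orbitMap (K := K) ρ v)
      apply_mem_toSubmodule := by
        rintro g _ ⟨f, rfl⟩
        exact ⟨cosetRep K g f, orbitMap_cosetRep hv g f⟩ }
  have hW : W = ⊤ := by
    refine (hρ.eq_bot_or_eq_top W).resolve_left fun h => hv0 ?_
    have h1 : v ∈ W.toSubmodule := ⟨baseVector K, orbitMap_baseVector hv⟩
    rw [h] at h1
    exact (Submodule.mem_bot ℂ).mp h1
  intro w
  have : w ∈ W.toSubmodule := by rw [hW]; exact Submodule.mem_top
  exact this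

theorem rank_lt_continuum_of_surjective {V : Type v} [AddCommGroup V] [Module ℂ V]
    (hcard : Cardinal.mk (G ⧸ K) < Cardinal.continuum) (f : (G ⧸ K →₀ ℂ) →ₗ[ℂ] V)
    (hf : Function.Surjective f) : Module.rank ℂ V < Cardinal.continuum := by
  have h1 := lift_rank_range_le f
  rw [LinearMap.range_eq_top.mpr hf, rank_top, rank_finsupp_self] at h1
  rw [← Cardinal.lift_lt_continuum.{v, u}]
  refine h1.trans_lt ?_
  rw [Cardinal.lift_lift]
  exact Cardinal.lift_lt_continuum.mpr hcard

/-- A nonzero fixed vector generates `V`, and averaging shows that it generates `V^K` over the Hecke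
algebra, so `V^K` is simple. As a quotient of `ℂ[G/K]`, `V` has dimension below the continuum. -/
theorem rank_fixedVectors_le_of_smooth [TopologicalSpace G] [IsTopologicalGroup G]
    (hKc : IsCompact (K : Set G)) (hKo : IsOpen (K : Set G))
    (hcard : Cardinal.mk (G ⧸ K) < Cardinal.continuum) {r n : ℕ}
    (hr : ¬ StandardIdentityEnd r (n + 1))
    (hA : ∀ a : Fin r → HeckeAlgebra K, standardPolynomial r _ a = 0)
    {V : Type v} [AddCommGroup V] [Module ℂ V] {ρ : Representation ℂ G V}
    (hρ : ρ.IsIrreducible) : Module.rank ℂ (fixedVectors ρ K) ≤ n := by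
  rcases subsingleton_or_nontrivial (fixedVectors ρ K) with hs | hs
  · rw [rank_subsingleton']
    exact zero_le
  obtain ⟨v, hv⟩ := exists_ne (0 : fixedVectors ρ K)
  have hsurj (v : fixedVectors ρ K) (hv : v ≠ 0) :
      Function.Surjective (orbitMap (K := K) ρ (v : V)) :=
    orbitMap_surjective_of_isIrreducible hρ v.2 fun h => hv (Subtype.ext h)
  refine rank_le_of_isSimple (HeckeAlgebra.action ρ) (fun v w hv => ?_)
    ((Submodule.rank_le _).trans_lt (rank_lt_continuum_of_surjective hcard _ (hsurj v hv))) hr hA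
  obtain ⟨f, hf⟩ := hsurj v hv w
  obtain ⟨a, ha⟩ := HeckeAlgebra.exists_orbitMap_eq hKc hKo v.2 (f := f) (hf ▸ w.2)
  exact ⟨a, Subtype.ext (ha.trans hf)⟩

end Irreducible

/-! ### Transport along linear equivalences -/

section Transport

variable {G : Type*} [Group G] {V V' : Type*} [AddCommGroup V] [Module ℂ V] [AddCommGroup V']
  [Module ℂ V']

/-- Transport of a representation along a linear equivalence. -/
def Representation.transport (ρ : Representation ℂ G V) (e : V ≃ₗ[ℂ] V') :
    Representation ℂ G V' where
  toFun g := e.toLinearMap ∘ₗ ρ g ∘ₗ e.symm.toLinearMap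
  map_one' := by ext; simp
  map_mul' g h := by ext; simp

theorem Representation.transport_apply (ρ : Representation ℂ G V) (e : V ≃ₗ[ℂ] V') (g : G)
    (x : V') : ρ.transport e g x = e (ρ g (e.symm x)) := rfl

theorem rank_fixedVectors_le_of_transport {ρ : Representation ℂ G V} (e : V ≃ₗ[ℂ] V')
    {K : Subgroup G} {n : ℕ} (h : Module.rank ℂ (fixedVectors (ρ.transport e) K) ≤ n) :
    Module.rank ℂ (fixedVectors ρ K) ≤ n := by
  have hmap : (fixedVectors ρ K).map e.toLinearMap = fixedVectors (ρ.transport e) K := by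
    ext x
    rw [Submodule.mem_map]
    constructor
    · rintro ⟨y, hy, rfl⟩ g hg
      rw [ρ.transport_apply]
      simp [hy g hg]
    · intro hx
      refine ⟨e.symm x, fun g hg => e.injective ?_, by simp⟩
      have := hx g hg
      rw [ρ.transport_apply] at this
      simp [this]
  have h1 := (e.submoduleMap (fixedVectors ρ K)).lift_rank_eq
  rw [show Module.rank ℂ ((fixedVectors ρ K).map (e : V →ₗ[ℂ] V')) =
    Module.rank ℂ (fixedVectors (ρ.transport e) K) by rw [← hmap]] at h1
  have h2 := Cardinal.lift_le.mpr h
  rw [← h1, Cardinal.lift_natCast] at h2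
  exact Cardinal.lift_le_nat_iff.mp h2

/-- The subrepresentation of `ρ` corresponding to one of a transported representation. -/
def Subrepresentation.ofTransport {ρ : Representation ℂ G V} (e : V ≃ₗ[ℂ] V')
    (W : Subrepresentation (ρ.transport e)) : Subrepresentation ρ where
  toSubmodule := W.toSubmodule.comap e.toLinearMap
  apply_mem_toSubmodule g x hx := by
    have := W.apply_mem_toSubmodule g hx
    rw [ρ.transport_apply] at this
    simpa using this

theorem Subrepresentation.eq_bot_or_eq_top_of_ofTransport {ρ : Representation ℂ G V}
    (e : V ≃ₗ[ℂ] V') {W : Subrepresentation (ρ.transport e)}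
    (h : W.ofTransport e = ⊥ ∨ W.ofTransport e = ⊤) : W = ⊥ ∨ W = ⊤ := by
  refine h.imp (fun h => ?_) fun h => ?_
  · refine Subrepresentation.toSubmodule_injective ((Submodule.eq_bot_iff _).mpr fun x hx => ?_)
    have : e.symm x ∈ (W.ofTransport e).toSubmodule := by
      change e (e.symm x) ∈ W.toSubmodule
      simpa using hx
    rw [h] at this
    simpa using (Submodule.mem_bot ℂ).mp this
  · refine Subrepresentation.toSubmodule_injective (Submodule.eq_top_iff'.mpr fun x => ?_)
    have : e.symm x ∈ (W.ofTransport e).toSubmodule := by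
      rw [h]
      exact Submodule.mem_top
    change e (e.symm x) ∈ W.toSubmodule at this
    simpa using this

/-- The inner product on a universe lift. -/
@[reducible] noncomputable def ULift.innerProductSpace (V : Type u) [NormedAddCommGroup V]
    [InnerProductSpace ℂ V] : InnerProductSpace ℂ (ULift.{v} V) where
  inner x y := inner ℂ x.down y.down
  norm_sq_eq_re_inner x := norm_sq_eq_re_inner x.down
  conj_inner_symm x y := inner_conj_symm x.down y.down
  add_left x y z := inner_add_left x.down y.down z.down
  smul_left x y c := inner_smul_left x.down y.down c

end Transport

/-! ### Applying the bounds to representations in the universe of `G` -/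

section UniverseLift

variable {G : Type u} [Group G] [TopologicalSpace G] {K : Subgroup G} {n : ℕ}

theorem SmoothFixedDimLE.rank_le (h : SmoothFixedDimLE.{u, w} G K n) {V : Type u} [AddCommGroup V]
    [Module ℂ V] {ρ : Representation ℂ G V} (hρ : IsSmoothRep ρ) (hirr : ρ.IsIrreducible) :
    Module.rank ℂ (fixedVectors ρ K) ≤ n := by
  let e : V ≃ₗ[ℂ] ULift.{w} V := ULift.moduleEquiv.symm
  refine rank_fixedVectors_le_of_transport e (h _ _ (fun x => ?_) ?_)
  · have : {g | ρ.transport e g x = x} = {g | ρ g (e.symm x) = e.symm x} := by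
      ext g
      change e (ρ g (e.symm x)) = x ↔ ρ g (e.symm x) = e.symm x
      rw [LinearEquiv.eq_symm_apply]
    rw [this]
    exact hρ _
  · have hnt : Nontrivial (Subrepresentation (ρ.transport e)) := by
      refine ⟨⊥, ⊤, fun hbt => ?_⟩
      have h1 : (⊥ : Subrepresentation ρ) = ⊤ := by
        refine Subrepresentation.toSubmodule_injective (Eq.symm
          ((Submodule.eq_bot_iff _).mpr fun x _ => ?_))
        have h2 : e x ∈ (⊤ : Subrepresentation (ρ.transport e)).toSubmodule := Submodule.mem_top
        rw [← hbt] at h2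
        exact e.map_eq_zero_iff.mp ((Submodule.mem_bot ℂ).mp h2)
      exact bot_ne_top h1
    exact { toNontrivial := hnt
            eq_bot_or_eq_top := fun W => W.eq_bot_or_eq_top_of_ofTransport e
              (hirr.eq_bot_or_eq_top _) }

theorem UnitaryFixedDimLE.rank_le (h : UnitaryFixedDimLE.{u, v} G K n) {V : Type u}
    [NormedAddCommGroup V] [InnerProductSpace ℂ V] [CompleteSpace V] {ρ : Representation ℂ G V}
    (hρ : IsUnitaryRep ρ) (hirr : IsTopologicallyIrreducible ρ) :
    Module.rank ℂ (fixedVectors ρ K) ≤ n := by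
  let e : V ≃ₗ[ℂ] ULift.{v} V := ULift.moduleEquiv.symm
  let _ : InnerProductSpace ℂ (ULift.{v} V) := ULift.innerProductSpace V
  refine rank_fixedVectors_le_of_transport e (h (ULift.{v} V) _ ⟨?_, ?_⟩ ⟨?_, fun W hW => ?_⟩)
  · exact continuous_uliftUp.comp (hρ.continuous_action.comp
      (continuous_fst.prodMk (continuous_uliftDown.comp continuous_snd)))
  · exact fun g x y => hρ.inner_map_map g x.down y.down
  · have := hirr.nontrivial
    exact e.symm.toEquiv.nontrivial
  · exact W.eq_bot_or_eq_top_of_ofTransport e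
      (hirr.eq_bot_or_eq_top _ (hW.preimage continuous_uliftUp))

end UniverseLift

/-! ### The identity in the Hecke algebra and the two implications -/

section Main

variable {G : Type u} [Group G] [TopologicalSpace G] [IsTopologicalGroup G] {K : Subgroup G}
  {r n : ℕ}

/-- A nonzero value of `S_r` would act nontrivially on `V^K` for some irreducible unitary `V`, where
`S_r` is an identity since `dim V^K ≤ n`. -/
theorem HeckeAlgebra.standardPolynomial_eq_zero_of_unitary (hKo : IsOpen (K : Set G))
    (h : UnitaryFixedDimLE.{u, v} G K n) (hr : ∀ d ≤ n, StandardIdentityEnd r d)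
    (a : Fin r → HeckeAlgebra K) : standardPolynomial r _ a = 0 := by
  by_contra hne
  obtain ⟨V, _, _, _, ρ, hρ, hirr, v, hv, hv0⟩ := exists_irreducible_orbitMap_ne_zero hKo
    (f := toVector (standardPolynomial r _ a)) fun h0 => hne (toVector_injective (by simpa using h0))
  refine hv0 ?_
  have h1 := map_standardPolynomial (action (K := K) ρ) a
  rw [standardPolynomial_end_eq_zero hr (h.rank_le hρ hirr)] at h1
  exact congrArg (fun T => ((T ⟨v, hv⟩ : fixedVectors ρ K) : V)) h1

theorem HeckeAlgebra.standardPolynomial_eq_zero_of_smooth (hKc : IsCompact (K : Set G))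
    (hKo : IsOpen (K : Set G)) (h : SmoothFixedDimLE.{u, w} G K n)
    (hr : ∀ d ≤ n, StandardIdentityEnd r d)
    (a : Fin r → HeckeAlgebra K) : standardPolynomial r _ a = 0 := by
  -- For each maximal left ideal, the value kills a fixed vector whose annihilator lies in that
  -- ideal.
  have hjac : standardPolynomial r _ a ∈ Ideal.jacobson (⊥ : Ideal (HeckeAlgebra K)) := by
    refine Ideal.mem_sInf.mpr fun {L} hL => ?_
    obtain ⟨W, _, _, ρ, hρ, hirr, w, hw, hwL⟩ := exists_irreducible_of_isMaximal hKc hKo hL.2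
    refine hwL _ ?_
    have h1 := map_standardPolynomial (action (K := K) ρ) a
    rw [standardPolynomial_end_eq_zero hr (h.rank_le hρ hirr)] at h1
    exact congrArg (fun T => ((T ⟨w, hw⟩ : fixedVectors ρ K) : W)) h1
  obtain ⟨V, _, _, _, ρ, hρ, v, hv, hinj⟩ := exists_unitaryRep_orbitMap_injective hKo
  have : CompleteSpace (fixedVectors ρ K) := hρ.isClosed_fixedVectors.completeSpace_coe
  have h0 := map_eq_zero_of_mem_jacobson (hρ.heckeAction (K := K))
    (hρ.exists_heckeAction_eq_star hKc hKo) hjac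
  have h1 := congrArg (fun T => ((T ⟨v, hv⟩ : fixedVectors ρ K) : V)) h0
  exact toVector_injective ((hinj _ h1).trans (map_zero _).symm)

theorem SmoothFixedDimLE.unitaryFixedDimLE (hKc : IsCompact (K : Set G))
    (hKo : IsOpen (K : Set G)) (h : SmoothFixedDimLE.{u, w} G K n) :
    UnitaryFixedDimLE.{u, v} G K n := by
  obtain ⟨r, hr, hr'⟩ := exists_standardIdentityEnd n
  have hA := HeckeAlgebra.standardPolynomial_eq_zero_of_smooth hKc hKo h hr
  intro V _ _ _ ρ hρ hirr
  have : CompleteSpace (fixedVectors ρ K) := hρ.isClosed_fixedVectors.completeSpace_coe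
  refine rank_le_of_standardPolynomial_eq_zero hr'
    (standardPolynomial_eq_zero_of_irreducible (B := (hρ.heckeAction (K := K)).range)
      (hρ.isIrreducibleOperatorSet_range_heckeAction hirr hKc hKo) ?_ ?_)
  · rintro _ ⟨a, rfl⟩
    obtain ⟨a', ha'⟩ := hρ.exists_heckeAction_eq_star hKc hKo a
    exact ⟨a', ha'⟩
  · intro b hb
    choose a ha using hb
    have h1 := map_standardPolynomial (hρ.heckeAction (K := K)) a
    rw [hA, map_zero] at h1
    rw [h1]
    exact congrArg _ (funext fun i => (ha i).symm)

theorem UnitaryFixedDimLE.smoothFixedDimLE (hKc : IsCompact (K : Set G))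
    (hKo : IsOpen (K : Set G)) (hcard : Cardinal.mk (G ⧸ K) < Cardinal.continuum)
    (h : UnitaryFixedDimLE.{u, v} G K n) : SmoothFixedDimLE.{u, w} G K n := by
  obtain ⟨r, hr, hr'⟩ := exists_standardIdentityEnd n
  intro V _ _ ρ _ hirr
  exact rank_fixedVectors_le_of_smooth hKc hKo hcard hr'
    (HeckeAlgebra.standardPolynomial_eq_zero_of_unitary hKo h hr) hirr

/-- The cardinality of `G ⧸ K` being less than the continuum does not depend on the compact open
subgroup `K`. -/
theorem mk_quotient_lt_continuum {K' : Subgroup G} (hKc : IsCompact (K : Set G))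
    (hKo' : IsOpen (K' : Set G)) (hcard : Cardinal.mk (G ⧸ K) < Cardinal.continuum) :
    Cardinal.mk (G ⧸ K') < Cardinal.continuum := by
  -- `K ⊓ K'` has finite index in `K`, so `G/(K ⊓ K')`, which surjects onto `G/K'`, is the product
  -- of `G/K` with a finite set.
  have hle : K ⊓ K' ≤ K := inf_le_left
  have : CompactSpace K := isCompact_iff_compactSpace.mp hKc
  have : Finite (K ⧸ (K ⊓ K').subgroupOf K) := by
    refine Subgroup.quotient_finite_of_isOpen _ ?_
    rw [Subgroup.inf_subgroupOf_left]
    exact hKo'.preimage continuous_subtype_val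
  have h1 : Cardinal.mk (G ⧸ K') ≤ Cardinal.mk (G ⧸ (K ⊓ K')) :=
    Cardinal.mk_le_of_surjective (f := Quotient.map' id fun a b h => by
      rw [QuotientGroup.leftRel_apply] at h ⊢
      exact h.2)
      (Quotient.ind' fun a => ⟨Quotient.mk'' a, rfl⟩)
  refine h1.trans_lt ?_
  rw [Cardinal.mk_congr (Subgroup.quotientEquivProdOfLE hle), Cardinal.mk_prod,
    Cardinal.lift_id, Cardinal.lift_id]
  exact Cardinal.mul_lt_of_lt Cardinal.aleph0_le_continuum hcard
    ((Cardinal.lt_aleph0_of_finite _).trans Cardinal.aleph0_lt_continuum)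

end Main

theorem theoremA (G : Type u) [Group G] [TopologicalSpace G] [IsTopologicalGroup G]
    [LocallyCompactSpace G] [TotallyDisconnectedSpace G] :
    -- the sharp form, for a fixed compact open subgroup and a fixed bound
    (∀ K : Subgroup G, IsCompact (K : Set G) → IsOpen (K : Set G) → ∀ n : ℕ,
      (Cardinal.mk (G ⧸ K) < Cardinal.continuum →
        (UnitaryFixedDimLE.{u, v} G K n ↔ SmoothFixedDimLE.{u, w} G K n)) ∧
      (SmoothFixedDimLE.{u, w} G K n → UnitaryFixedDimLE.{u, v} G K n)) ∧
    -- uniform admissibility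
    ((∃ K : Subgroup G, IsCompact (K : Set G) ∧ IsOpen (K : Set G) ∧
        Cardinal.mk (G ⧸ K) < Cardinal.continuum) →
      (UnitaryUniformlyAdmissible.{u, v} G ↔ SmoothUniformlyAdmissible.{u, w} G)) ∧
    (SmoothUniformlyAdmissible.{u, w} G → UnitaryUniformlyAdmissible.{u, v} G) := by
  have hsu : SmoothUniformlyAdmissible.{u, w} G → UnitaryUniformlyAdmissible.{u, v} G :=
    fun h K hKc hKo => (h K hKc hKo).imp fun n hn => hn.unitaryFixedDimLE hKc hKo
  refine ⟨fun K hKc hKo n => ⟨fun hcard => ⟨fun h => h.smoothFixedDimLE hKc hKo hcard,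
    fun h => h.unitaryFixedDimLE hKc hKo⟩, fun h => h.unitaryFixedDimLE hKc hKo⟩, ?_, hsu⟩
  rintro ⟨K₀, hK₀c, hK₀o, hcard⟩
  refine ⟨fun h K hKc hKo => (h K hKc hKo).imp fun n hn => ?_, hsu⟩
  exact hn.smoothFixedDimLE hKc hKo (mk_quotient_lt_continuum hK₀c hKo hcard)
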